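/- For each dimension $d\ge 1$ let $f=N(0,I)$ be the standard Gaussian distribution on $\mathbb{R}^d$ and let $A=A_d\subset\mathbb{R}^d$ be a measurable set, with $p_f(A)=\int_A f$, and assume that $\inf_{d\ge 1} p_f(A)>0$. Let $f|_A=f\,\mathbf 1_A/p_f(A)$ be the distribution $f$ conditioned on $A$, and let $\mu_A$ and $\Sigma_A$ be the mean and the covariance matrix of $f|_A$. Let $n_g=n_g(d)$ be a sequence of integers and, for each $d$, let $Y_{A,1},\dots,Y_{A,n_g}$ be i.i.d. random vectors with distribution $N(\mu_A,\Sigma_A)$. Put $$\hat\mu_A=\frac1{n_g}\sum_{k=1}^{n_g}Y_{A,k},\qquad \hat\Sigma_A=\frac1{n_g}\sum_{k=1}^{n_g}Y_{A,k}Y_{A,k}^\top-\hat\mu_A\hat\mu_A^\top,\qquad \hat g_A=N(\hat\mu_A,\hat\Sigma_A),$$ and let $D(f\|\hat g_A)\in[0,\infty]$ be the Kullback--Leibler divergence. For sequences $u,v$ indexed by $d$, write $u\gg v$, or equivalently $v\ll u$, if $u/v\to\infty$ as $d\to\infty$. Assume that $n_g\gg d$. Then: (a) if $n_g\gg d^2$,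 then $\sup_d\mathbb{E}[D(f\|\hat g_A)]<\infty$, where the supremum is over all $d\ge1$ with $n_g(d)\ge d+3$ (that is, over all but finitely many $d$, because $n_g\gg d$); (b) if $n_g\ll d^2$, then $\mathbb{E}[D(f\|\hat g_A)]\to\infty$ as $d\to\infty$. -/

import Mathlib

open MeasureTheory ProbabilityTheory InformationTheory Filter Topology
open scoped ENNReal

noncomputable section

namespace GaussianIS

/-- The standard Gaussian distribution `f = N(0, I)` on `ℝ^d`. -/
abbrev f (d : ℕ) : Measure (EuclideanSpace ℝ (Fin d)) :=
  stdGaussian (EuclideanSpace ℝ (Fin d))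

/-- The conditional distribution `f|_A`, that is `f` restricted to `A` and divided by `p_f(A)`. -/
def condLaw {d : ℕ} (A : Set (EuclideanSpace ℝ (Fin d))) :
    Measure (EuclideanSpace ℝ (Fin d)) :=
  ProbabilityTheory.cond (f d) A

/-- The mean `μ_A = E_{f|_A}(X)`. -/
def meanA {d : ℕ} (A : Set (EuclideanSpace ℝ (Fin d))) : EuclideanSpace ℝ (Fin d) :=
  ∫ x, x ∂(condLaw A)

/-- The covariance matrix `Σ_A = E_{f|_A}(X Xᵀ) - μ_A μ_Aᵀ`. -/
def covA {d : ℕ} (A : Set (EuclideanSpace ℝ (Fin d))) : Matrix (Fin d) (Fin d) ℝ :=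
  Matrix.of fun i j => (∫ x, x i * x j ∂(condLaw A)) - meanA A i * meanA A j

/-- The empirical mean `(1/n) ∑ₖ yₖ` of a sample of size `n`. -/
def sampleMean {d n : ℕ} (y : Fin n → EuclideanSpace ℝ (Fin d)) : EuclideanSpace ℝ (Fin d) :=
  (1 / (n : ℝ)) • ∑ k, y k

/-- The empirical covariance matrix `(1/n) ∑ₖ yₖ yₖᵀ - μ̂ μ̂ᵀ` of a sample of size `n`. -/
def sampleCov {d n : ℕ} (y : Fin n → EuclideanSpace ℝ (Fin d)) : Matrix (Fin d) (Fin d) ℝ :=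
  Matrix.of fun i j =>
    (1 / (n : ℝ)) * (∑ k, y k i * y k j) - sampleMean y i * sampleMean y j

/-- The estimated Gaussian distribution `ĝ = N(μ̂, Σ̂)`. -/
def gHat {d n : ℕ} (y : Fin n → EuclideanSpace ℝ (Fin d)) :
    Measure (EuclideanSpace ℝ (Fin d)) :=
  multivariateGaussian (sampleMean y) (sampleCov y)

/-- The expected Kullback–Leibler divergence `E(D(f ‖ ĝ))` in `[0, ∞]`, where `ĝ` is computed from
the random sample `Y`. -/
def expectedKL {Ω : Type*} [MeasurableSpace Ω] (P : Measure Ω) {d n : ℕ}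
    (Y : Fin n → Ω → EuclideanSpace ℝ (Fin d)) : ℝ≥0∞ :=
  ∫⁻ ω, klDiv (f d) (gHat fun k => Y k ω) ∂P

/-- `u ≫ v` for two sequences indexed by the dimension: `u / v → ∞` as `d → ∞`. -/
def MuchLarger (u v : ℕ → ℝ) : Prop :=
  Tendsto (fun d => u d / v d) atTop atTop

end GaussianIS

end

/-!
Let `S` and `v` be the covariance and the mean of the sampled Gaussian. The sample mean is
independent of the sample covariance `Ŝ`, and `n Ŝ = S^{1/2} W S^{1/2}`, where `W` is the Gram
matrix of `d` independent standard Gaussian vectors in the `(n - 1)`-dimensional space of centered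
vectors of `ℝⁿ`.
Since `𝔼 W⁻¹ = (n - d - 2)⁻¹ I`, the divergence has the expectation
`2 𝔼 D = log det S - d - d log n + 𝔼 log det W + (n (tr S⁻¹ + vᵀ S⁻¹ v) + d) / (n - d - 2)`.
Jensen's inequality on the squared distances whose product is `det W` locates `𝔼 log det W`, and
`𝔼 D` turns out to be of order `d² / n` as soon as `‖v‖`, `‖S - I‖_F` and `S⁻¹` are bounded.

They are bounded independently of the dimension because the conditioned law has a density `≤ C` with
respect to `f`. Passing from `f` to such a law moves the integral of `h` by at most `√(C Var_f h)`:
linear forms `h` then bound `v`, and quadratic forms that are diagonal in an eigenbasis of `S` bound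
`‖S - I‖_F`. A bounded density also keeps the one-dimensional marginals from concentrating, so that
`S ≥ c I` for some `c > 0`.
-/

namespace GaussianIS

open scoped RealInnerProductSpace Matrix MatrixOrder
open Matrix (gram)

section StdGaussian

variable {E F : Type*} [NormedAddCommGroup E] [InnerProductSpace ℝ E] [FiniteDimensional ℝ E]
  [MeasurableSpace E] [BorelSpace E] [NormedAddCommGroup F] [InnerProductSpace ℝ F]
  [FiniteDimensional ℝ F] [MeasurableSpace F] [BorelSpace F]

lemma map_toLp_pi_stdGaussian {ι : Type*} [Fintype ι] :
    (Measure.pi fun _ : ι => stdGaussian E).map (WithLp.toLp 2) =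
      stdGaussian (PiLp 2 fun _ : ι => E) := by
  apply Measure.ext_of_charFun
  ext t
  rw [charFun_stdGaussian, charFun_pi]
  simp_rw [charFun_stdGaussian, ← Complex.exp_sum, ← Complex.ofReal_pow, PiLp.norm_sq_eq_of_L2]
  simp [Finset.sum_div, neg_div]

lemma map_toLp_prod_stdGaussian :
    ((stdGaussian E).prod (stdGaussian F)).map (WithLp.toLp 2) =
      stdGaussian (WithLp 2 (E × F)) := by
  apply Measure.ext_of_charFun
  ext t
  rw [charFun_stdGaussian, charFun_prod]
  simp_rw [charFun_stdGaussian, ← Complex.exp_add, ← Complex.ofReal_pow,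
    WithLp.prod_norm_sq_eq_of_L2]
  congr 1
  push_cast
  simp only [WithLp.fst, WithLp.snd]
  ring

lemma map_stdGaussian_of_adjoint_norm_eq {T : E → F} {S : F → E} (hT : Measurable T)
    (hTS : ∀ x t, ⟪T x, t⟫ = ⟪x, S t⟫) (hS : ∀ t, ‖S t‖ = ‖t‖) :
    (stdGaussian E).map T = stdGaussian F := by
  apply Measure.ext_of_charFun
  ext t
  rw [charFun_apply, integral_map hT.aemeasurable (by fun_prop)]
  simp_rw [hTS]
  rw [← charFun_apply, charFun_stdGaussian, charFun_stdGaussian, hS]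

lemma map_orthogonalProjectionOnto_stdGaussian (W : Submodule ℝ E) :
    (stdGaussian E).map W.orthogonalProjectionOnto = stdGaussian W :=
  map_stdGaussian_of_adjoint_norm_eq (S := (↑)) (by fun_prop)
    (fun x t => Submodule.inner_orthogonalProjectionOnto_eq_of_mem_right t x) fun _ => rfl

lemma map_inner_stdGaussian (u : E) :
    (stdGaussian E).map (fun x => ⟪u, x⟫) = gaussianReal 0 (‖u‖ ^ 2).toNNReal := by
  have h := IsGaussian.map_eq_gaussianReal (μ := stdGaussian E) (innerSL ℝ u)
  rwa [integral_strongDual_stdGaussian, variance_dual_stdGaussian, innerSL_apply_norm] at h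

lemma stdGaussian_submodule_eq_zero {V : Submodule ℝ E} (hV : V ≠ ⊤) :
    stdGaussian E (V : Set E) = 0 := by
  obtain ⟨u, hu, hu0⟩ := V.orthogonal.ne_bot_iff.1 (by rwa [ne_eq, Submodule.orthogonal_eq_bot_iff])
  have : NullSingletonClass (gaussianReal 0 (‖u‖ ^ 2).toNNReal) :=
    nullSingletonClass_gaussianReal (by simpa using hu0)
  have hu_null : stdGaussian E ((fun x => ⟪u, x⟫) ⁻¹' {0}) = 0 := by
    rw [← Measure.map_apply (by fun_prop) (measurableSet_singleton _), map_inner_stdGaussian,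
      measure_singleton]
  exact measure_mono_null (fun x hx => Submodule.inner_left_of_mem_orthogonal hx hu) hu_null

lemma integrable_norm_sq_stdGaussian : Integrable (fun x => ‖x‖ ^ 2) (stdGaussian E) :=
  (IsGaussian.memLp_two_id (μ := stdGaussian E)).integrable_norm_pow (by norm_num)

lemma integral_inner_sq_stdGaussian (u : E) : ∫ x, ⟪u, x⟫ ^ 2 ∂(stdGaussian E) = ‖u‖ ^ 2 := by
  have h := variance_dual_stdGaussian (innerSL ℝ u)
  rwa [variance_of_integral_eq_zero (by fun_prop) (integral_strongDual_stdGaussian _),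
    innerSL_apply_norm] at h

lemma integral_norm_sq_stdGaussian :
    ∫ x, ‖x‖ ^ 2 ∂(stdGaussian E) = Module.finrank ℝ E := by
  have b := stdOrthonormalBasis ℝ E
  simp_rw [← b.sum_sq_inner_right]
  have hint : ∀ i, Integrable (fun x => ⟪b i, x⟫ ^ 2) (stdGaussian E) := fun i =>
    (IsGaussian.memLp_dual (stdGaussian E) (innerSL ℝ (b i)) 2 (by simp)).integrable_sq
  rw [integral_finsetSum _ fun i _ => hint i]
  simp [integral_inner_sq_stdGaussian]

lemma integral_exp_neg_mul_sq_gaussianReal {t : ℝ} (ht : 0 ≤ t) :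
    ∫ x, Real.exp (-(t * x ^ 2)) ∂(gaussianReal 0 1) = (1 + 2 * t) ^ (-(1 / 2 : ℝ)) := by
  have hpdf : ∀ x : ℝ, gaussianPDFReal 0 1 x • Real.exp (-(t * x ^ 2)) =
      (√(2 * Real.pi))⁻¹ * Real.exp (-(t + 1 / 2) * x ^ 2) := by
    intro x
    simp only [gaussianPDFReal, NNReal.coe_one, mul_one, sub_zero, smul_eq_mul, mul_assoc]
    rw [← Real.exp_add]
    ring_nf
  rw [integral_gaussianReal_eq_integral_smul one_ne_zero]
  simp_rw [hpdf]
  rw [integral_const_mul, integral_gaussian, Real.rpow_neg (by linarith), ← Real.sqrt_eq_rpow,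
    ← Real.sqrt_inv, ← Real.sqrt_inv, ← Real.sqrt_mul (by positivity)]
  congr 1
  field_simp
  ring

lemma integral_exp_neg_mul_norm_sq_stdGaussian {t : ℝ} (ht : 0 ≤ t) :
    ∫ x, Real.exp (-(t * ‖x‖ ^ 2)) ∂(stdGaussian E) =
      (1 + 2 * t) ^ (-(Module.finrank ℝ E / 2 : ℝ)) := by
  have b := stdOrthonormalBasis ℝ E
  have hprod : ∀ x : Fin (Module.finrank ℝ E) → ℝ,
      Real.exp (-(t * ‖∑ i, x i • b i‖ ^ 2)) = ∏ i, Real.exp (-(t * x i ^ 2)) := by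
    intro x
    simp_rw [← Real.exp_sum, ← b.sum_sq_inner_right (∑ i, x i • b i),
      b.orthonormal.inner_right_fintype, Finset.mul_sum, Finset.sum_neg_distrib]
  rw [stdGaussian_eq_map_pi_orthonormalBasis b,
    integral_map (Measurable.aemeasurable (by fun_prop)) (by fun_prop)]
  simp_rw [hprod]
  rw [integral_fintype_prod_eq_prod (fun _ (y : ℝ) => Real.exp (-(t * y ^ 2)))]
  simp_rw [integral_exp_neg_mul_sq_gaussianReal ht]
  rw [Finset.prod_const, ← Real.rpow_natCast, ← Real.rpow_mul (by linarith), Finset.card_univ,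
    Fintype.card_fin]
  ring_nf

lemma lintegral_exp_neg_mul_norm_sq_stdGaussian {t : ℝ} (ht : 0 ≤ t) :
    ∫⁻ x, ENNReal.ofReal (Real.exp (-(t * ‖x‖ ^ 2))) ∂(stdGaussian E) =
      ENNReal.ofReal ((1 + 2 * t) ^ (-(Module.finrank ℝ E / 2 : ℝ))) := by
  have hI : Integrable (fun x : E => Real.exp (-(t * ‖x‖ ^ 2))) (stdGaussian E) := by
    refine Integrable.of_bound (C := 1) (by fun_prop) (.of_forall fun x => ?_)
    rw [Real.norm_eq_abs, abs_of_pos (Real.exp_pos _), Real.exp_le_one_iff, Left.neg_nonpos_iff]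
    positivity
  rw [← ofReal_integral_eq_lintegral_ofReal hI (.of_forall fun x => (Real.exp_pos _).le),
    integral_exp_neg_mul_norm_sq_stdGaussian ht]

lemma lintegral_Ioi_one_add_two_mul_rpow {k : ℝ} (hk : 2 < k) :
    ∫⁻ t in Set.Ioi (0 : ℝ), ENNReal.ofReal ((1 + 2 * t) ^ (-(k / 2))) =
      ENNReal.ofReal (1 / (k - 2)) := by
  have hderiv : ∀ t ∈ Set.Ici (0 : ℝ), HasDerivAt
      (fun t : ℝ => -(1 / (k - 2)) * (1 + 2 * t) ^ (-(k / 2) + 1))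
      ((1 + 2 * t) ^ (-(k / 2))) t := by
    intro t (ht : 0 ≤ t)
    have h1 : HasDerivAt (fun t : ℝ => 1 + 2 * t) 2 t := by
      simpa using ((hasDerivAt_id t).const_mul 2).const_add 1
    refine ((h1.rpow_const (p := -(k / 2) + 1) (Or.inl (by linarith))).const_mul
      (-(1 / (k - 2)))).congr_deriv ?_
    have : k - 2 ≠ 0 := by linarith
    rw [add_sub_cancel_right]
    field_simp
    ring
  have hlim : Tendsto (fun t : ℝ => -(1 / (k - 2)) * (1 + 2 * t) ^ (-(k / 2) + 1)) atTop
      (𝓝 0) := by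
    have h0 : Tendsto (fun t : ℝ => 1 + 2 * t) atTop atTop :=
      tendsto_atTop_add_const_left _ _ (tendsto_id.const_mul_atTop two_pos)
    have h := (tendsto_rpow_neg_atTop (y := k / 2 - 1) (by linarith)).comp h0
    simpa [Function.comp_def, neg_sub, sub_eq_neg_add, add_comm] using h.const_mul (-(1 / (k - 2)))
  have hnonneg : ∀ t ∈ Set.Ioi (0 : ℝ), 0 ≤ (1 + 2 * t) ^ (-(k / 2)) := fun t (ht : 0 < t) =>
    Real.rpow_nonneg (by linarith) _
  have hint := integrableOn_Ioi_deriv_of_nonneg' hderiv hnonneg hlim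
  rw [← ofReal_integral_eq_lintegral_ofReal hint
    ((ae_restrict_iff' measurableSet_Ioi).2 (.of_forall hnonneg)),
    integral_Ioi_of_hasDerivAt_of_tendsto' hderiv hint hlim]
  simp

lemma lintegral_Ioi_exp_neg_mul {s : ℝ} (hs : 0 < s) :
    ∫⁻ t in Set.Ioi (0 : ℝ), ENNReal.ofReal (Real.exp (-(t * s))) = ENNReal.ofReal s⁻¹ := by
  have hI := integrableOn_exp_mul_Ioi (a := -s) (by linarith) 0
  have h := integral_exp_mul_Ioi (a := -s) (by linarith) 0
  simp_rw [mul_comm _ s, ← neg_mul]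
  rw [← ofReal_integral_eq_lintegral_ofReal hI (.of_forall fun x => (Real.exp_pos _).le), h]
  simp

-- Write `‖x‖⁻²` as `∫₀^∞ exp (-t ‖x‖²) dt` and exchange the integrals.
lemma lintegral_inv_norm_sq_stdGaussian (hE : 3 ≤ Module.finrank ℝ E) :
    ∫⁻ x, ENNReal.ofReal (‖x‖ ^ 2)⁻¹ ∂(stdGaussian E) =
      ENNReal.ofReal (1 / (Module.finrank ℝ E - 2 : ℝ)) := by
  have : Nontrivial E := Module.nontrivial_of_finrank_pos (R := ℝ) (by omega)
  have hne : ∀ᵐ x ∂(stdGaussian E), x ≠ 0 := by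
    simpa using measure_eq_zero_iff_ae_notMem.1
      (stdGaussian_submodule_eq_zero (bot_ne_top (α := Submodule ℝ E)))
  calc ∫⁻ x, ENNReal.ofReal (‖x‖ ^ 2)⁻¹ ∂(stdGaussian E)
      = ∫⁻ x, (∫⁻ t in Set.Ioi (0 : ℝ), ENNReal.ofReal (Real.exp (-(t * ‖x‖ ^ 2))))
          ∂(stdGaussian E) := by
        refine lintegral_congr_ae (hne.mono fun x hx => ?_)
        exact (lintegral_Ioi_exp_neg_mul (by positivity)).symm
    _ = ∫⁻ t in Set.Ioi (0 : ℝ), ∫⁻ x, ENNReal.ofReal (Real.exp (-(t * ‖x‖ ^ 2)))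
          ∂(stdGaussian E) := by
        refine lintegral_lintegral_swap (Measurable.aemeasurable ?_)
        simp only [Function.uncurry_def]
        fun_prop
    _ = ∫⁻ t in Set.Ioi (0 : ℝ),
          ENNReal.ofReal ((1 + 2 * t) ^ (-(Module.finrank ℝ E / 2 : ℝ))) :=
        setLIntegral_congr_fun measurableSet_Ioi fun t ht =>
          lintegral_exp_neg_mul_norm_sq_stdGaussian (le_of_lt ht)
    _ = _ := lintegral_Ioi_one_add_two_mul_rpow (by exact_mod_cast hE)

end StdGaussian

section PosDef

variable {ι : Type*} {M : Matrix ι ι ℝ}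

lemma posSemidef_abs_apply_le [Finite ι] (hM : M.PosSemidef) (i j : ι) :
    |M i j| ≤ M i i + M j j := by
  classical
  have := Fintype.ofFinite ι
  have hsymm : M j i = M i j := by simpa using hM.1.apply i j
  have hquad : ∀ s : ℝ, 0 ≤ M i i + 2 * s * M i j + s ^ 2 * M j j := by
    intro s
    have h := hM.dotProduct_mulVec_nonneg (Pi.single i 1 + Pi.single j s)
    simp only [star_trivial, Matrix.mulVec_add, Matrix.mulVec_single, dotProduct_add,
      add_dotProduct, single_dotProduct, Pi.smul_apply, Matrix.col_apply,
      MulOpposite.smul_eq_mul_unop, MulOpposite.unop_op, hsymm] at h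
    linarith
  have hii : 0 ≤ M i i := hM.diag_nonneg
  have hjj : 0 ≤ M j j := hM.diag_nonneg
  exact abs_le.2 ⟨by linarith [hquad 1], by linarith [hquad (-1)]⟩

variable [Fintype ι] [DecidableEq ι]

lemma log_det_le_trace_sub_card (hM : M.PosDef) :
    Real.log M.det ≤ M.trace - Fintype.card ι := by
  rw [hM.1.det_eq_prod_eigenvalues, hM.1.trace_eq_sum_eigenvalues]
  simp only [RCLike.ofReal_real_eq_id, id]
  rw [Real.log_prod fun i _ => (hM.eigenvalues_pos i).ne']
  calc ∑ i, Real.log (hM.1.eigenvalues i) ≤ ∑ i, (hM.1.eigenvalues i - 1) :=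
        Finset.sum_le_sum fun i _ => Real.log_le_sub_one_of_pos (hM.eigenvalues_pos i)
    _ = _ := by simp

lemma card_sub_trace_inv_le_log_det (hM : M.PosDef) :
    Fintype.card ι - M⁻¹.trace ≤ Real.log M.det := by
  have h := log_det_le_trace_sub_card hM.inv
  rw [Matrix.det_nonsing_inv, Ring.inverse_eq_inv', Real.log_inv] at h
  linarith

end PosDef

section MeasurableMatrix

variable {α ι : Type*} [MeasurableSpace α] [Fintype ι] [DecidableEq ι] {M : α → Matrix ι ι ℝ}

lemma measurable_matrix_det (hM : ∀ i j, Measurable fun a => M a i j) :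
    Measurable fun a => (M a).det := by
  simp only [Matrix.det_apply]
  fun_prop

lemma measurable_matrix_inv (hM : ∀ i j, Measurable fun a => M a i j) (i j : ι) :
    Measurable fun a => (M a)⁻¹ i j := by
  simp only [Matrix.inv_def, Matrix.smul_apply, Ring.inverse_eq_inv', smul_eq_mul,
    Matrix.adjugate_apply]
  refine (measurable_matrix_det hM).inv.mul (measurable_matrix_det fun k l => ?_)
  by_cases hk : k = j
  · simp [hk]
  · simpa [Matrix.updateRow_ne hk] using hM k l

end MeasurableMatrix

section Gram

variable {E : Type*} [NormedAddCommGroup E] [InnerProductSpace ℝ E]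
  {ι : Type*} [Fintype ι] [DecidableEq ι] {d : ℕ}

omit [DecidableEq ι] in
lemma gram_sum_smul {κ : Type*} (B : Matrix κ ι ℝ) (x : ι → E) :
    gram ℝ (fun i => ∑ j, B i j • x j) = B * gram ℝ x * Bᵀ := by
  ext i k
  simp only [Matrix.gram_apply, sum_inner, inner_sum, real_inner_smul_left, real_inner_smul_right,
    Matrix.mul_apply, Matrix.transpose_apply, Finset.sum_mul]
  exact Finset.sum_congr rfl fun j _ => Finset.sum_congr rfl fun l _ => by ring

lemma inner_sum_inv_gram_smul {x : ι → E} (hx : LinearIndependent ℝ x) (i k : ι) :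
    ⟪∑ j, (gram ℝ x)⁻¹ i j • x j, x k⟫ = (1 : Matrix ι ι ℝ) i k := by
  have hdet := (Matrix.det_gram_ne_zero_iff_linearIndependent (𝕜 := ℝ)).2 hx
  simp only [sum_inner, real_inner_smul_left, ← Matrix.gram_apply]
  rw [← Matrix.mul_apply, Matrix.nonsing_inv_mul _ hdet.isUnit]

-- `∑ j, (gram ℝ x)⁻¹ i j • x j`, dual to `x i`, is orthogonal to the other vectors, hence equal to
-- its own projection, which is `(gram ℝ x)⁻¹ i i` times that of `x i`.
lemma inv_gram_apply_self [FiniteDimensional ℝ E] {x : ι → E} (hx : LinearIndependent ℝ x)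
    (i : ι) :
    (gram ℝ x)⁻¹ i i =
      (‖(Submodule.span ℝ (x '' {i}ᶜ))ᗮ.orthogonalProjectionOnto (x i)‖ ^ 2)⁻¹ := by
  set V := Submodule.span ℝ (x '' {i}ᶜ)
  set y := ∑ j, (gram ℝ x)⁻¹ i j • x j with hy
  have hyV : y ∈ Vᗮ := by
    have hVy : V ≤ (ℝ ∙ y)ᗮ := by
      refine Submodule.span_le.2 (Set.image_subset_iff.2 fun j hj => ?_)
      refine Submodule.mem_orthogonal_singleton_iff_inner_right.2 ?_
      rw [inner_sum_inv_gram_smul hx, Matrix.one_apply_ne (Ne.symm hj)]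
    exact fun v hv => Submodule.mem_orthogonal_singleton_iff_inner_left.1 (hVy hv)
  have hproj : y = (gram ℝ x)⁻¹ i i • Vᗮ.starProjection (x i) := by
    rw [← Vᗮ.starProjection_eq_self_iff.2 hyV, hy, map_sum, Finset.sum_eq_single i]
    · exact map_smul _ _ _
    · intro j _ hj
      rw [map_smul, Submodule.starProjection_orthogonal_apply_eq_zero
        (Submodule.subset_span (Set.mem_image_of_mem x hj)), smul_zero]
    · simp
  have hdual : ⟪y, x i⟫ = 1 := by rw [inner_sum_inv_gram_smul hx, Matrix.one_apply_eq]
  rw [hproj, real_inner_smul_left] at hdual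
  rw [← Vᗮ.re_inner_starProjection_eq_normSq (x i), RCLike.re_to_real]
  exact eq_inv_of_mul_eq_one_left hdual

lemma det_gram_mul_inv_gram_zero {x : Fin (d + 1) → E} (hx : LinearIndependent ℝ x) :
    (gram ℝ x).det * (gram ℝ x)⁻¹ 0 0 = (gram ℝ fun j : Fin d => x j.succ).det := by
  have hdet := (Matrix.det_gram_ne_zero_iff_linearIndependent (𝕜 := ℝ)).2 hx
  rw [Matrix.inv_def, Matrix.smul_apply, Ring.inverse_eq_inv', smul_eq_mul,
    mul_inv_cancel_left₀ hdet, Matrix.adjugate_fin_succ_eq_det_submatrix, Fin.val_zero, add_zero,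
    pow_zero, one_mul, Fin.succAbove_zero]
  rfl

lemma le_log_det_gram_succ {x : Fin (d + 1) → E} (hx : LinearIndependent ℝ x) {a : ℝ}
    (ha : 0 < a) :
    Real.log (gram ℝ fun j : Fin d => x j.succ).det + (1 + Real.log a - a * (gram ℝ x)⁻¹ 0 0) ≤
      Real.log (gram ℝ x).det := by
  have hG := Matrix.posDef_gram_of_linearIndependent hx
  have h00 : 0 < (gram ℝ x)⁻¹ 0 0 := hG.inv.diag_pos
  have hlog := Real.log_le_sub_one_of_pos (mul_pos ha h00)
  rw [Real.log_mul ha.ne' h00.ne'] at hlog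
  rw [← det_gram_mul_inv_gram_zero hx, Real.log_mul hG.det_pos.ne' h00.ne']
  linarith

lemma linearIndependent_insertNth (i : Fin (d + 1)) {v : E} {x : Fin d → E}
    (hx : LinearIndependent ℝ x) (hv : v ∉ Submodule.span ℝ (Set.range x)) :
    LinearIndependent ℝ (i.insertNth v x : Fin (d + 1) → E) := by
  have h := linearIndependent_finCons.2 ⟨hx, hv⟩
  rwa [← linearIndependent_equiv i.cycleRange, Fin.cons_comp_cycleRange] at h

lemma insertNth_image_compl_singleton {α : Type*} (i : Fin (d + 1)) (v : α) (x : Fin d → α) :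
    (i.insertNth v x : Fin (d + 1) → α) '' {i}ᶜ = Set.range x := by
  rw [← Fin.range_succAbove, ← Set.range_comp]
  simp [Function.comp_def]

variable [MeasurableSpace E] [BorelSpace E] [FiniteDimensional ℝ E]

omit [Fintype ι] [DecidableEq ι] in
lemma measurable_gram_apply (i j : ι) : Measurable fun x : ι → E => gram ℝ x i j := by
  simp only [Matrix.gram_apply]
  fun_prop

lemma measurable_det_gram : Measurable fun x : ι → E => (gram ℝ x).det :=
  measurable_matrix_det measurable_gram_apply

lemma measurable_inv_gram (i j : ι) : Measurable fun x : ι → E => (gram ℝ x)⁻¹ i j :=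
  measurable_matrix_inv measurable_gram_apply i j

omit [Fintype ι] [DecidableEq ι] in
lemma measurableSet_linearIndependent [Finite ι] :
    MeasurableSet {x : ι → E | LinearIndependent ℝ x} := by
  classical
  have := Fintype.ofFinite ι
  simp only [← Matrix.det_gram_ne_zero_iff_linearIndependent (𝕜 := ℝ)]
  exact (measurableSet_eq_fun measurable_det_gram measurable_const).compl

end Gram

section GaussianGram

variable {E : Type*} [NormedAddCommGroup E] [InnerProductSpace ℝ E] [FiniteDimensional ℝ E]
  [MeasurableSpace E] [BorelSpace E] {d : ℕ}

lemma lintegral_pi_stdGaussian_succ (i : Fin (d + 1)) {F : (Fin (d + 1) → E) → ℝ≥0∞}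
    (hF : Measurable F) :
    ∫⁻ x, F x ∂(Measure.pi fun _ => stdGaussian E) =
      ∫⁻ x, ∫⁻ v, F (i.insertNth v x) ∂(stdGaussian E) ∂(Measure.pi fun _ => stdGaussian E) := by
  have h := (measurePreserving_piFinSuccAbove (fun _ : Fin (d + 1) => stdGaussian E) i).symm
  rw [← h.lintegral_comp hF, lintegral_prod_symm _ (by fun_prop)]
  rfl

lemma ae_notMem_span (hd : d < Module.finrank ℝ E) (x : Fin d → E) :
    ∀ᵐ v ∂(stdGaussian E), v ∉ Submodule.span ℝ (Set.range x) := by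
  refine measure_eq_zero_iff_ae_notMem.1 (stdGaussian_submodule_eq_zero fun h => ?_)
  have hcard := finrank_range_le_card (R := ℝ) x
  rw [Set.finrank, h, finrank_top, Fintype.card_fin] at hcard
  omega

lemma ae_linearIndependent (hd : d ≤ Module.finrank ℝ E) :
    ∀ᵐ x ∂(Measure.pi fun _ : Fin d => stdGaussian E), LinearIndependent ℝ x := by
  induction d with
  | zero => exact .of_forall fun x => linearIndependent_empty_type
  | succ d ih =>
    have hmeas := (measurableSet_linearIndependent (E := E) (ι := Fin (d + 1))).compl
    change (Measure.pi fun _ => stdGaussian E) {x : Fin (d + 1) → E | LinearIndependent ℝ x}ᶜ = 0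
    rw [← lintegral_indicator_one hmeas,
      lintegral_pi_stdGaussian_succ 0 (measurable_one.indicator hmeas)]
    refine lintegral_eq_zero_of_ae_eq_zero ?_
    filter_upwards [ih (by omega)] with x hx
    refine lintegral_eq_zero_of_ae_eq_zero ?_
    filter_upwards [ae_notMem_span (by omega) x] with v hv
    exact Set.indicator_of_notMem (Set.notMem_compl_iff.2 (linearIndependent_insertNth 0 hx hv)) _

lemma ae_posDef_gram (hd : d ≤ Module.finrank ℝ E) :
    ∀ᵐ x ∂(Measure.pi fun _ : Fin d => stdGaussian E), (gram ℝ x).PosDef :=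
  (ae_linearIndependent hd).mono fun _ => Matrix.posDef_gram_of_linearIndependent

lemma lintegral_inv_gram_insertNth {x : Fin d → E} (hx : LinearIndependent ℝ x)
    (hd : d + 3 ≤ Module.finrank ℝ E) (i : Fin (d + 1)) :
    ∫⁻ v, ENNReal.ofReal ((gram ℝ (i.insertNth v x : Fin (d + 1) → E))⁻¹ i i) ∂(stdGaussian E) =
      ENNReal.ofReal (1 / (Module.finrank ℝ E - d - 2)) := by
  set V := Submodule.span ℝ (Set.range x)
  have hrank : Module.finrank ℝ V + Module.finrank ℝ Vᗮ = Module.finrank ℝ E :=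
    V.finrank_add_finrank_orthogonal
  have hV : Module.finrank ℝ V = d := by simpa using finrank_span_eq_card hx
  calc _ = ∫⁻ v, ENNReal.ofReal (‖Vᗮ.orthogonalProjectionOnto v‖ ^ 2)⁻¹ ∂(stdGaussian E) := by
        refine lintegral_congr_ae ?_
        filter_upwards [ae_notMem_span (by omega) x] with v hv
        rw [inv_gram_apply_self (linearIndependent_insertNth i hx hv) i,
          insertNth_image_compl_singleton, Fin.insertNth_apply_same]
    _ = ∫⁻ y, ENNReal.ofReal (‖y‖ ^ 2)⁻¹ ∂(stdGaussian Vᗮ) := by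
        rw [← map_orthogonalProjectionOnto_stdGaussian,
          lintegral_map (by fun_prop) (by fun_prop)]
    _ = _ := by
        rw [lintegral_inv_norm_sq_stdGaussian (by omega), ← hrank, hV]
        push_cast
        ring_nf

lemma lintegral_inv_gram_apply_self (hd : d + 2 ≤ Module.finrank ℝ E) (i : Fin d) :
    ∫⁻ x, ENNReal.ofReal ((gram ℝ x)⁻¹ i i) ∂(Measure.pi fun _ : Fin d => stdGaussian E) =
      ENNReal.ofReal (1 / (Module.finrank ℝ E - d - 1)) := by
  cases d with
  | zero => exact i.elim0
  | succ d =>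
    rw [lintegral_pi_stdGaussian_succ i (measurable_inv_gram i i).ennreal_ofReal]
    calc _ = ∫⁻ _, ENNReal.ofReal (1 / (Module.finrank ℝ E - d - 2))
            ∂(Measure.pi fun _ : Fin d => stdGaussian E) := by
          refine lintegral_congr_ae ?_
          filter_upwards [ae_linearIndependent (E := E) (d := d) (by omega)] with x hx
          exact lintegral_inv_gram_insertNth hx (by omega) i
      _ = _ := by
          rw [lintegral_const, measure_univ, mul_one]
          push_cast
          ring_nf

lemma integrable_inv_gram_apply (hd : d + 2 ≤ Module.finrank ℝ E) (i j : Fin d) :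
    Integrable (fun x : Fin d → E => (gram ℝ x)⁻¹ i j) (Measure.pi fun _ => stdGaussian E) := by
  have hpos : ∀ x : Fin d → E, (gram ℝ x)⁻¹.PosSemidef := fun x =>
    (Matrix.posSemidef_gram (𝕜 := ℝ) x).inv
  have hdiag : ∀ k, Integrable (fun x : Fin d → E => (gram ℝ x)⁻¹ k k)
      (Measure.pi fun _ => stdGaussian E) := fun k => by
    refine ⟨(measurable_inv_gram k k).aestronglyMeasurable, ?_⟩
    rw [hasFiniteIntegral_iff_ofReal (.of_forall fun x => (hpos x).diag_nonneg),
      lintegral_inv_gram_apply_self hd]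
    exact ENNReal.ofReal_lt_top
  exact ((hdiag i).add (hdiag j)).mono' (measurable_inv_gram i j).aestronglyMeasurable
    (.of_forall fun x => posSemidef_abs_apply_le (hpos x) i j)

lemma integral_inv_gram_apply_self (hd : d + 2 ≤ Module.finrank ℝ E) (i : Fin d) :
    ∫ x, (gram ℝ x)⁻¹ i i ∂(Measure.pi fun _ : Fin d => stdGaussian E) =
      1 / (Module.finrank ℝ E - d - 1) := by
  have hd' : (d + 2 : ℝ) ≤ Module.finrank ℝ E := by exact_mod_cast hd
  rw [integral_eq_lintegral_of_nonneg_ae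
      (.of_forall fun x => (Matrix.posSemidef_gram (𝕜 := ℝ) x).inv.diag_nonneg)
      (measurable_inv_gram i i).aestronglyMeasurable, lintegral_inv_gram_apply_self hd,
    ENNReal.toReal_ofReal (one_div_nonneg.2 (by linarith))]

-- Reversing the sign of the `i`-th vector preserves the law and changes the sign of the entry.
lemma integral_inv_gram_apply_of_ne {i j : Fin d} (hij : i ≠ j) :
    ∫ x, (gram ℝ x)⁻¹ i j ∂(Measure.pi fun _ : Fin d => stdGaussian E) = 0 := by
  set s : Fin d → ℝ := fun k => if k = i then -1 else 1 with hs
  have hss : Matrix.diagonal s * Matrix.diagonal s = 1 := by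
    rw [Matrix.diagonal_mul_diagonal, ← Matrix.diagonal_one]
    congr 1 with k
    simp only [hs]
    split_ifs <;> norm_num
  have hflip : MeasurePreserving (fun (x : Fin d → E) k => s k • x k)
      (Measure.pi fun _ => stdGaussian E) (Measure.pi fun _ => stdGaussian E) := by
    refine measurePreserving_pi _ _ fun k => ⟨by fun_prop, ?_⟩
    refine map_stdGaussian_of_adjoint_norm_eq (S := fun t => s k • t) (by fun_prop)
      (fun x t => by rw [real_inner_smul_left, real_inner_smul_right]) fun t => ?_
    simp only [hs, norm_smul]
    split_ifs <;> simp
  have hgram : ∀ x : Fin d → E, (gram ℝ fun k => s k • x k)⁻¹ =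
      Matrix.diagonal s * (gram ℝ x)⁻¹ * Matrix.diagonal s := by
    intro x
    have h := gram_sum_smul (Matrix.diagonal s) x
    simp only [Matrix.diagonal_apply, ite_smul, zero_smul, Finset.sum_ite_eq, Finset.mem_univ,
      if_true, Matrix.diagonal_transpose] at h
    rw [h, Matrix.mul_inv_rev, Matrix.mul_inv_rev, Matrix.inv_eq_right_inv hss, Matrix.mul_assoc]
  have hneg : ∀ x : Fin d → E, (gram ℝ fun k => s k • x k)⁻¹ i j = -(gram ℝ x)⁻¹ i j := by
    intro x
    rw [hgram, Matrix.mul_diagonal, Matrix.diagonal_mul]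
    simp [hs, hij.symm]
  have hint := integral_map (μ := Measure.pi fun _ : Fin d => stdGaussian E)
    hflip.aemeasurable (measurable_inv_gram i j).aestronglyMeasurable
  simp_rw [hflip.map_eq, hneg, integral_neg] at hint
  linarith

lemma integrable_trace_mul_inv_gram (hd : d + 2 ≤ Module.finrank ℝ E)
    (M : Matrix (Fin d) (Fin d) ℝ) :
    Integrable (fun x : Fin d → E => (M * (gram ℝ x)⁻¹).trace)
      (Measure.pi fun _ => stdGaussian E) := by
  simp only [Matrix.trace, Matrix.diag, Matrix.mul_apply]
  exact integrable_finsetSum _ fun i _ => integrable_finsetSum _ fun j _ =>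
    (integrable_inv_gram_apply hd j i).const_mul _

lemma integral_trace_mul_inv_gram (hd : d + 2 ≤ Module.finrank ℝ E)
    (M : Matrix (Fin d) (Fin d) ℝ) :
    ∫ x, (M * (gram ℝ x)⁻¹).trace ∂(Measure.pi fun _ : Fin d => stdGaussian E) =
      M.trace / (Module.finrank ℝ E - d - 1) := by
  have hint := fun i j => (integrable_inv_gram_apply (E := E) hd j i).const_mul (M i j)
  simp only [Matrix.trace, Matrix.diag, Matrix.mul_apply]
  rw [integral_finsetSum _ fun i _ => integrable_finsetSum _ fun j _ => hint i j, Finset.sum_div]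
  refine Finset.sum_congr rfl fun i _ => ?_
  rw [integral_finsetSum _ fun j _ => hint i j, Finset.sum_eq_single i]
  · rw [integral_const_mul, integral_inv_gram_apply_self hd, mul_one_div]
  · intro j _ hj
    rw [integral_const_mul, integral_inv_gram_apply_of_ne hj, mul_zero]
  · simp

lemma integrable_norm_sq_apply (i : Fin d) :
    Integrable (fun x : Fin d → E => ‖x i‖ ^ 2) (Measure.pi fun _ => stdGaussian E) :=
  (measurePreserving_eval (fun _ : Fin d => stdGaussian E) i).integrable_comp_of_integrable
    integrable_norm_sq_stdGaussian

lemma integrable_trace_gram :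
    Integrable (fun x : Fin d → E => (gram ℝ x).trace) (Measure.pi fun _ => stdGaussian E) := by
  simp only [Matrix.trace, Matrix.diag, Matrix.gram_apply, real_inner_self_eq_norm_sq]
  exact integrable_finsetSum _ fun i _ => integrable_norm_sq_apply i

lemma integral_trace_gram :
    ∫ x, (gram ℝ x).trace ∂(Measure.pi fun _ : Fin d => stdGaussian E) =
      d * Module.finrank ℝ E := by
  simp only [Matrix.trace, Matrix.diag, Matrix.gram_apply, real_inner_self_eq_norm_sq]
  rw [integral_finsetSum _ fun i _ => integrable_norm_sq_apply i]
  have heval : ∀ i : Fin d, ∫ x, ‖x i‖ ^ 2 ∂(Measure.pi fun _ : Fin d => stdGaussian E) =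
      Module.finrank ℝ E := fun i =>
    (integral_comp_eval (μ := fun _ : Fin d => stdGaussian E) (f := fun y : E => ‖y‖ ^ 2)
      (by fun_prop)).trans integral_norm_sq_stdGaussian
  simp [heval]

lemma integrable_log_det_gram (hd : d + 2 ≤ Module.finrank ℝ E) :
    Integrable (fun x : Fin d → E => Real.log (gram ℝ x).det)
      (Measure.pi fun _ => stdGaussian E) := by
  have hinv := integrable_trace_mul_inv_gram (E := E) hd 1
  refine integrable_of_le_of_le measurable_det_gram.log.aestronglyMeasurable ?_ ?_
    ((integrable_const (d : ℝ)).sub hinv) (integrable_trace_gram.sub (integrable_const (d : ℝ)))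
  · filter_upwards [ae_posDef_gram (E := E) (d := d) (by omega)] with x hx
    simpa using card_sub_trace_inv_le_log_det hx
  · filter_upwards [ae_posDef_gram (E := E) (d := d) (by omega)] with x hx
    simpa using log_det_le_trace_sub_card hx

lemma integral_log_det_gram_le (hd : d + 2 ≤ Module.finrank ℝ E) :
    ∫ x, Real.log (gram ℝ x).det ∂(Measure.pi fun _ : Fin d => stdGaussian E) ≤
      d * Real.log (Module.finrank ℝ E) := by
  have hN : 0 < (Module.finrank ℝ E : ℝ) := by exact_mod_cast (by omega : 0 < Module.finrank ℝ E)
  have hle : ∀ᵐ x ∂(Measure.pi fun _ : Fin d => stdGaussian E), Real.log (gram ℝ x).det ≤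
      d * Real.log (Module.finrank ℝ E) + ((Module.finrank ℝ E : ℝ)⁻¹ * (gram ℝ x).trace - d) := by
    filter_upwards [ae_posDef_gram (E := E) (d := d) (by omega)] with x hx
    have h := log_det_le_trace_sub_card (hx.smul (inv_pos.2 hN))
    rw [Matrix.det_smul, Real.log_mul (by positivity) hx.det_pos.ne', Real.log_pow, Real.log_inv,
      Matrix.trace_smul, smul_eq_mul, Fintype.card_fin] at h
    linarith
  have htr := (integrable_trace_gram (E := E) (d := d)).const_mul (Module.finrank ℝ E : ℝ)⁻¹
  have htr_sub := htr.sub (integrable_const (d : ℝ))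
  refine (integral_mono_ae (integrable_log_det_gram hd) ((integrable_const _).add htr_sub)
    hle).trans_eq ?_
  rw [integral_add' (integrable_const _) htr_sub, integral_sub' htr (integrable_const _),
    integral_const_mul, integral_const_mul, integral_trace_gram]
  simp [mul_comm (d : ℝ), hN.ne']

lemma sum_log_le_integral_log_det_gram (hd : d + 2 ≤ Module.finrank ℝ E) :
    ∑ i ∈ Finset.range d, Real.log (Module.finrank ℝ E - i - 2) ≤
      ∫ x, Real.log (gram ℝ x).det ∂(Measure.pi fun _ : Fin d => stdGaussian E) := by
  induction d with
  | zero => simp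
  | succ d ih =>
    set a : ℝ := Module.finrank ℝ E - d - 2
    have ha : 0 < a := by
      have : ((d + 1 + 2 : ℕ) : ℝ) ≤ Module.finrank ℝ E := by exact_mod_cast hd
      push_cast at this
      linarith
    have htail : MeasurePreserving (fun (x : Fin (d + 1) → E) (j : Fin d) => x j.succ)
        (Measure.pi fun _ => stdGaussian E) (Measure.pi fun _ => stdGaussian E) :=
      measurePreserving_snd.comp
        (measurePreserving_piFinSuccAbove (fun _ : Fin (d + 1) => stdGaussian E) 0)
    have hlog := integrable_log_det_gram (E := E) (d := d) (by omega)
    have hlog_tail : Integrable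
        (fun x : Fin (d + 1) → E => Real.log (gram ℝ fun j : Fin d => x j.succ).det)
        (Measure.pi fun _ => stdGaussian E) := htail.integrable_comp_of_integrable hlog
    have hinv := (integrable_inv_gram_apply hd (0 : Fin (d + 1)) 0).const_mul a
    have hconst := integrable_const (μ := Measure.pi fun _ : Fin (d + 1) => stdGaussian E)
      (1 + Real.log a)
    have hsub : Integrable (fun x : Fin (d + 1) → E => 1 + Real.log a - a * (gram ℝ x)⁻¹ 0 0)
        (Measure.pi fun _ => stdGaussian E) := hconst.sub hinv
    have htail_eq : ∫ x, Real.log (gram ℝ fun j : Fin d => x j.succ).det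
        ∂(Measure.pi fun _ : Fin (d + 1) => stdGaussian E) =
        ∫ x, Real.log (gram ℝ x).det ∂(Measure.pi fun _ : Fin d => stdGaussian E) := by
      rw [← htail.map_eq, integral_map htail.aemeasurable (by rw [htail.map_eq]; exact hlog.1)]
    have hinv_eq : a * ∫ x, (gram ℝ x)⁻¹ 0 0 ∂(Measure.pi fun _ : Fin (d + 1) => stdGaussian E) =
        1 := by
      rw [integral_inv_gram_apply_self hd, mul_one_div, div_eq_one_iff_eq] <;>
        push_cast <;> linarith
    calc _ ≤ ∫ x, Real.log (gram ℝ x).det ∂(Measure.pi fun _ : Fin d => stdGaussian E) +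
            Real.log a := by
          rw [Finset.sum_range_succ]
          linarith [ih (by omega)]
      _ = ∫ x, (Real.log (gram ℝ fun j : Fin d => x j.succ).det +
            (1 + Real.log a - a * (gram ℝ x)⁻¹ 0 0))
            ∂(Measure.pi fun _ : Fin (d + 1) => stdGaussian E) := by
          rw [integral_add hlog_tail hsub, integral_sub hconst hinv,
            integral_const_mul, hinv_eq, htail_eq]
          simp
      _ ≤ _ := by
          refine integral_mono_ae (hlog_tail.add hsub) (integrable_log_det_gram hd) ?_
          filter_upwards [ae_linearIndependent (E := E) (d := d + 1) (by omega)] with x hx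
          exact le_log_det_gram_succ hx ha

end GaussianGram

section Density

variable {E : Type*} [NormedAddCommGroup E] [InnerProductSpace ℝ E] [FiniteDimensional ℝ E]
  [MeasurableSpace E] [BorelSpace E]

/-- The density of the standard Gaussian distribution with respect to the Lebesgue measure. -/
noncomputable def stdGaussianPDF (x : E) : ℝ :=
  (2 * Real.pi) ^ (-(Module.finrank ℝ E / 2 : ℝ)) * Real.exp (-(‖x‖ ^ 2 / 2))

omit [FiniteDimensional ℝ E] [MeasurableSpace E] [BorelSpace E] in
lemma stdGaussianPDF_pos (x : E) : 0 < stdGaussianPDF x := by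
  unfold stdGaussianPDF
  positivity

omit [FiniteDimensional ℝ E] in
@[fun_prop]
lemma measurable_stdGaussianPDF : Measurable (stdGaussianPDF (E := E)) := by
  unfold stdGaussianPDF
  fun_prop

lemma integrable_stdGaussianPDF : Integrable (stdGaussianPDF (E := E)) := by
  have h := (GaussianFourier.integrable_cexp_neg_mul_sq_norm_add (V := E) (b := 1 / 2)
    (by norm_num) 0 0).norm
  refine Integrable.const_mul (h.congr (.of_forall fun x => ?_)) _
  simp only [Complex.norm_exp]
  congr 1
  simp [← Complex.ofReal_pow]
  ring

lemma integral_stdGaussianPDF_mul_cexp (t : E) :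
    ∫ x, (stdGaussianPDF x : ℂ) * Complex.exp (⟪x, t⟫ * Complex.I) =
      Complex.exp (-‖t‖ ^ 2 / 2) := by
  set K : ℝ := (2 * Real.pi) ^ (-(Module.finrank ℝ E / 2 : ℝ)) with hK
  have hp : 0 < 2 * Real.pi := by positivity
  have hpdf : ∀ x : E, (stdGaussianPDF x : ℂ) * Complex.exp (⟪x, t⟫ * Complex.I) =
      K * Complex.exp (-(1 / 2) * ‖x‖ ^ 2 + Complex.I * ⟪t, x⟫) := fun x => by
    rw [stdGaussianPDF, ← hK, Complex.ofReal_mul, mul_assoc, Complex.ofReal_exp,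
      ← Complex.exp_add, real_inner_comm]
    push_cast
    ring_nf
  have hone : (K : ℂ) * (Real.pi / (1 / 2) : ℂ) ^ (Module.finrank ℝ E / 2 : ℂ) = 1 := by
    rw [show (Real.pi / (1 / 2) : ℂ) = ((2 * Real.pi : ℝ) : ℂ) by push_cast; ring,
      show (Module.finrank ℝ E / 2 : ℂ) = ((Module.finrank ℝ E / 2 : ℝ) : ℂ) by push_cast; rfl,
      ← Complex.ofReal_cpow hp.le, ← Complex.ofReal_mul, hK, ← Real.rpow_add hp]
    simp
  simp_rw [hpdf]
  rw [integral_const_mul, GaussianFourier.integral_cexp_neg_mul_sq_norm_add (by norm_num),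
    ← mul_assoc, hone, one_mul, Complex.I_sq]
  ring_nf

lemma stdGaussian_eq_withDensity_volume :
    stdGaussian E = volume.withDensity fun x => ENNReal.ofReal (stdGaussianPDF x) := by
  have : IsFiniteMeasure (volume.withDensity fun x : E => ENNReal.ofReal (stdGaussianPDF x)) :=
    isFiniteMeasure_withDensity_ofReal integrable_stdGaussianPDF.2
  refine Measure.ext_of_charFun (funext fun t => ?_)
  rw [charFun_stdGaussian, charFun_apply, integral_withDensity_eq_integral_toReal_smul
    (by fun_prop) (.of_forall fun x => ENNReal.ofReal_lt_top), ← integral_stdGaussianPDF_mul_cexp]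
  simp_rw [ENNReal.toReal_ofReal (stdGaussianPDF_pos _).le, Complex.real_smul]

lemma volume_eq_abs_det_smul_map_affine (T : E ≃L[ℝ] E) (v : E) :
    (volume : Measure E) = ENNReal.ofReal |LinearMap.det (T : E →ₗ[ℝ] E)| •
      volume.map fun x => v + T x := by
  have hdet : LinearMap.det (T : E →ₗ[ℝ] E) ≠ 0 := T.toLinearEquiv.isUnit_det'.ne_zero
  have hlin : (volume : Measure E).map T =
      ENNReal.ofReal |(LinearMap.det (T : E →ₗ[ℝ] E))⁻¹| • volume :=
    Measure.map_linearMap_addHaar_eq_smul_addHaar volume hdet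
  rw [show (fun x => v + T x) = (fun x => v + x) ∘ T from rfl,
    ← Measure.map_map (by fun_prop) (by fun_prop), hlin, Measure.map_smul, map_add_left_eq_self,
    smul_smul, ← ENNReal.ofReal_mul (abs_nonneg _), ← abs_mul, mul_inv_cancel₀ hdet]
  simp

lemma stdGaussian_eq_withDensity_map_affine (T : E ≃L[ℝ] E) (v : E) :
    stdGaussian E = ((stdGaussian E).map fun x => v + T x).withDensity fun x =>
      ENNReal.ofReal (|LinearMap.det (T : E →ₗ[ℝ] E)| *
        Real.exp (‖T.symm (x - v)‖ ^ 2 / 2 - ‖x‖ ^ 2 / 2)) := by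
  have hpdf : ∀ x, stdGaussianPDF (v + T x) =
      stdGaussianPDF x * Real.exp (‖x‖ ^ 2 / 2 - ‖v + T x‖ ^ 2 / 2) := fun x => by
    rw [stdGaussianPDF, stdGaussianPDF, mul_assoc, ← Real.exp_add]
    congr 2
    ring
  refine Measure.ext_of_lintegral _ fun g hg => ?_
  rw [lintegral_withDensity_eq_lintegral_mul _ (by fun_prop) hg, lintegral_map (by fun_prop)
    (by fun_prop), stdGaussian_eq_withDensity_volume, lintegral_withDensity_eq_lintegral_mul _
    (by fun_prop) hg, lintegral_withDensity_eq_lintegral_mul _ (by fun_prop) (by fun_prop)]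
  conv_lhs => rw [volume_eq_abs_det_smul_map_affine T v]
  rw [lintegral_smul_measure, lintegral_map (by fun_prop) (by fun_prop), smul_eq_mul,
    ← lintegral_const_mul _ (by fun_prop)]
  congr 1 with x
  simp only [Pi.mul_apply, add_sub_cancel_left, ContinuousLinearEquiv.symm_apply_apply]
  rw [← mul_assoc, ← mul_assoc, ← ENNReal.ofReal_mul (abs_nonneg _),
    ← ENNReal.ofReal_mul (stdGaussianPDF_pos x).le, hpdf, mul_left_comm]

lemma klDiv_stdGaussian_map_affine (T : E ≃L[ℝ] E) (v : E)
    (hint : Integrable (fun x => ‖T.symm (x - v)‖ ^ 2) (stdGaussian E)) :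
    klDiv (stdGaussian E) ((stdGaussian E).map fun x => v + T x) =
      ENNReal.ofReal (Real.log |LinearMap.det (T : E →ₗ[ℝ] E)| +
        (∫ x, ‖T.symm (x - v)‖ ^ 2 ∂(stdGaussian E)) / 2 - Module.finrank ℝ E / 2) := by
  set ν := (stdGaussian E).map fun x => v + T x
  have hprob : IsProbabilityMeasure ν :=
    Measure.isProbabilityMeasure_map (Measurable.aemeasurable (by fun_prop))
  have hdet : LinearMap.det (T : E →ₗ[ℝ] E) ≠ 0 := T.toLinearEquiv.isUnit_det'.ne_zero
  have hdens := stdGaussian_eq_withDensity_map_affine T v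
  have hac : stdGaussian E ≪ ν := hdens ▸ withDensity_absolutelyContinuous _ _
  have hrn := Measure.rnDeriv_withDensity ν (f := fun x =>
    ENNReal.ofReal (|LinearMap.det (T : E →ₗ[ℝ] E)| *
      Real.exp (‖T.symm (x - v)‖ ^ 2 / 2 - ‖x‖ ^ 2 / 2))) (by fun_prop)
  rw [← hdens] at hrn
  have hllr : llr (stdGaussian E) ν =ᵐ[stdGaussian E] fun x =>
      Real.log |LinearMap.det (T : E →ₗ[ℝ] E)| + (‖T.symm (x - v)‖ ^ 2 / 2 - ‖x‖ ^ 2 / 2) := by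
    filter_upwards [hac.ae_le hrn] with x hx
    simp only [llr_def]
    rw [hx, ENNReal.toReal_ofReal (by positivity),
      Real.log_mul (by simpa using hdet) (Real.exp_pos _).ne', Real.log_exp]
  have hnorm := (integrable_norm_sq_stdGaussian (E := E)).div_const 2
  have hsub : Integrable (fun x => ‖T.symm (x - v)‖ ^ 2 / 2 - ‖x‖ ^ 2 / 2) (stdGaussian E) :=
    (hint.div_const 2).sub hnorm
  rw [klDiv_of_ac_of_integrable hac ((integrable_congr hllr).2 ((integrable_const _).add hsub)),
    integral_congr_ae hllr, integral_add (integrable_const _) hsub,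
    integral_sub (hint.div_const 2) hnorm]
  simp only [integral_div, integral_norm_sq_stdGaussian, integral_const, probReal_univ, one_smul,
    add_sub_assoc, sub_self, add_zero]

end Density

section QuadraticForm

variable {ι : Type*} [Fintype ι] [DecidableEq ι] {m : EuclideanSpace ℝ ι} {S : Matrix ι ι ℝ}

lemma integrable_apply_mul_apply_multivariateGaussian (i j : ι) :
    Integrable (fun x => x i * x j) (multivariateGaussian m S) :=
  MemLp.integrable_mul (IsGaussian.memLp_two_id.eval_piLp i) (IsGaussian.memLp_two_id.eval_piLp j)

lemma integral_apply_multivariateGaussian (i : ι) :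
    ∫ x, x i ∂(multivariateGaussian m S) = m i := by
  simpa using ContinuousLinearMap.integral_comp_comm (EuclideanSpace.proj (𝕜 := ℝ) i)
    (IsGaussian.integrable_id (μ := multivariateGaussian m S))

lemma integral_apply_mul_apply_multivariateGaussian (hS : S.PosSemidef) (i j : ι) :
    ∫ x, x i * x j ∂(multivariateGaussian m S) = S i j + m i * m j := by
  have h := covariance_eval_multivariateGaussian (μ := m) hS i j
  rw [covariance_eq_sub (IsGaussian.memLp_two_id.eval_piLp i)
    (IsGaussian.memLp_two_id.eval_piLp j), integral_apply_multivariateGaussian,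
    integral_apply_multivariateGaussian] at h
  exact eq_add_of_sub_eq h

omit [DecidableEq ι] in
lemma dotProduct_mulVec_eq_sum (M : Matrix ι ι ℝ) (x : ι → ℝ) :
    x ⬝ᵥ M *ᵥ x = ∑ i, ∑ j, M i j * (x i * x j) := by
  simp only [dotProduct, Matrix.mulVec, Finset.mul_sum]
  exact Finset.sum_congr rfl fun i _ => Finset.sum_congr rfl fun j _ => by ring

lemma integrable_quadratic_multivariateGaussian (M : Matrix ι ι ℝ) :
    Integrable (fun x => x.ofLp ⬝ᵥ M *ᵥ x.ofLp) (multivariateGaussian m S) := by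
  simp only [dotProduct_mulVec_eq_sum]
  exact integrable_finsetSum _ fun i _ => integrable_finsetSum _ fun j _ =>
    (integrable_apply_mul_apply_multivariateGaussian i j).const_mul _

lemma integral_quadratic_multivariateGaussian (hS : S.PosSemidef) (M : Matrix ι ι ℝ) :
    ∫ x, x.ofLp ⬝ᵥ M *ᵥ x.ofLp ∂(multivariateGaussian m S) =
      (M * S).trace + m.ofLp ⬝ᵥ M *ᵥ m.ofLp := by
  have hint := fun i j =>
    (integrable_apply_mul_apply_multivariateGaussian (m := m) (S := S) i j).const_mul (M i j)
  have hval : ∀ i j, ∫ x, M i j * (x i * x j) ∂(multivariateGaussian m S) =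
      M i j * S j i + M i j * (m i * m j) := fun i j => by
    rw [integral_const_mul, integral_apply_mul_apply_multivariateGaussian hS, mul_add,
      show S i j = S j i by simpa using hS.1.apply j i]
  simp only [dotProduct_mulVec_eq_sum]
  rw [integral_finsetSum _ fun i _ => integrable_finsetSum _ fun j _ => hint i j]
  simp_rw [integral_finsetSum _ fun j _ => hint _ j, hval, Finset.sum_add_distrib]
  simp only [Matrix.trace, Matrix.diag, Matrix.mul_apply]

end QuadraticForm

section GaussianKL

variable {ι : Type*} [Fintype ι] {S : Matrix ι ι ℝ}

open scoped Classical in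
lemma sqrt_mul_sqrt (hS : S.PosDef) : CFC.sqrt S * CFC.sqrt S = S :=
  CFC.sqrt_mul_sqrt_self S hS.posSemidef.nonneg

open scoped Classical in
lemma transpose_sqrt (S : Matrix ι ι ℝ) : (CFC.sqrt S)ᵀ = CFC.sqrt S := by
  simpa [isSelfAdjoint_iff, Matrix.star_eq_conjTranspose] using
    (CFC.sqrt_nonneg S).isSelfAdjoint

variable [DecidableEq ι]

/-- The closed form of the Kullback–Leibler divergence `D(N(0, I) ‖ N(m, S))`, for positive
definite `S`. -/
noncomputable def gaussianKL (m : ι → ℝ) (S : Matrix ι ι ℝ) : ℝ :=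
  (Real.log S.det - Fintype.card ι + S⁻¹.trace + m ⬝ᵥ S⁻¹ *ᵥ m) / 2

lemma gaussianKL_nonneg (m : ι → ℝ) (hS : S.PosDef) : 0 ≤ gaussianKL m S := by
  have hquad : 0 ≤ m ⬝ᵥ S⁻¹ *ᵥ m := by simpa using hS.inv.posSemidef.dotProduct_mulVec_nonneg m
  have hlog := card_sub_trace_inv_le_log_det hS
  rw [gaussianKL]
  linarith

lemma isUnit_det_sqrt (hS : S.PosDef) : IsUnit (CFC.sqrt S).det := by
  rw [isUnit_iff_ne_zero]
  intro h
  have := congrArg Matrix.det (sqrt_mul_sqrt hS)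
  rw [Matrix.det_mul, h, zero_mul] at this
  exact hS.det_pos.ne this

lemma log_abs_det_sqrt (hS : S.PosDef) : Real.log |(CFC.sqrt S).det| = Real.log S.det / 2 := by
  have hR := (isUnit_det_sqrt hS).ne_zero
  conv_rhs => rw [← sqrt_mul_sqrt hS]
  rw [Matrix.det_mul, Real.log_mul hR hR, Real.log_abs]
  ring

lemma norm_toEuclideanCLM_inv_sqrt_sq (hS : S.PosDef) (x : EuclideanSpace ℝ ι) :
    ‖Matrix.toEuclideanCLM (𝕜 := ℝ) (CFC.sqrt S)⁻¹ x‖ ^ 2 = x.ofLp ⬝ᵥ S⁻¹ *ᵥ x.ofLp := by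
  conv_rhs => rw [← sqrt_mul_sqrt hS]
  rw [EuclideanSpace.real_norm_sq_eq, Matrix.mul_inv_rev, ← Matrix.mulVec_mulVec,
    Matrix.dotProduct_mulVec, ← Matrix.mulVec_transpose, Matrix.transpose_nonsing_inv,
    transpose_sqrt]
  simp only [Matrix.ofLp_toEuclideanCLM, dotProduct, sq]

/-- An invertible matrix as a continuous linear equivalence of Euclidean spaces. -/
noncomputable def euclideanEquiv (R : Matrix ι ι ℝ) (hR : IsUnit R.det) :
    EuclideanSpace ℝ ι ≃L[ℝ] EuclideanSpace ℝ ι :=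
  .equivOfInverse (Matrix.toEuclideanCLM (𝕜 := ℝ) R) (Matrix.toEuclideanCLM (𝕜 := ℝ) R⁻¹)
    (fun x => by
      rw [← mul_apply_eq_comp, ← map_mul, Matrix.nonsing_inv_mul _ hR, map_one]; rfl)
    (fun x => by
      rw [← mul_apply_eq_comp, ← map_mul, Matrix.mul_nonsing_inv _ hR, map_one]; rfl)

lemma det_euclideanEquiv {R : Matrix ι ι ℝ} (hR : IsUnit R.det) :
    LinearMap.det (euclideanEquiv R hR : EuclideanSpace ℝ ι →ₗ[ℝ] EuclideanSpace ℝ ι) = R.det := by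
  rw [← LinearMap.det_toLin (EuclideanSpace.basisFun ι ℝ).toBasis]
  rfl

lemma klDiv_stdGaussian_multivariateGaussian (m : EuclideanSpace ℝ ι) (hS : S.PosDef) :
    klDiv (stdGaussian (EuclideanSpace ℝ ι)) (multivariateGaussian m S) =
      ENNReal.ofReal (gaussianKL m.ofLp S) := by
  set T := euclideanEquiv (CFC.sqrt S) (isUnit_det_sqrt hS) with hT
  have hnorm : ∀ x, ‖T.symm (x - m)‖ ^ 2 = (-m + x).ofLp ⬝ᵥ S⁻¹ *ᵥ (-m + x).ofLp := fun x => by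
    rw [neg_add_eq_sub]
    exact norm_toEuclideanCLM_inv_sqrt_sq hS _
  have hshift : (stdGaussian (EuclideanSpace ℝ ι)).map (fun x => -m + x) =
      multivariateGaussian (-m) 1 := by
    simp [multivariateGaussian]
  have hmeas : AEStronglyMeasurable (fun x : EuclideanSpace ℝ ι => x.ofLp ⬝ᵥ S⁻¹ *ᵥ x.ofLp)
      ((stdGaussian (EuclideanSpace ℝ ι)).map fun x => -m + x) := by
    rw [hshift]
    exact (integrable_quadratic_multivariateGaussian S⁻¹).1
  have hint : Integrable (fun x => ‖T.symm (x - m)‖ ^ 2) (stdGaussian (EuclideanSpace ℝ ι)) := by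
    simp_rw [hnorm]
    refine (integrable_map_measure hmeas (by fun_prop)).1 ?_
    rw [hshift]
    exact integrable_quadratic_multivariateGaussian S⁻¹
  have hval : ∫ x, ‖T.symm (x - m)‖ ^ 2 ∂(stdGaussian (EuclideanSpace ℝ ι)) =
      S⁻¹.trace + m.ofLp ⬝ᵥ S⁻¹ *ᵥ m.ofLp := by
    simp_rw [hnorm]
    rw [← integral_map (by fun_prop) hmeas, hshift,
      integral_quadratic_multivariateGaussian Matrix.PosSemidef.one]
    simp [Matrix.mulVec_neg]
  refine (klDiv_stdGaussian_map_affine T m hint).trans ?_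
  rw [hT, det_euclideanEquiv, ← hT, log_abs_det_sqrt hS, hval, finrank_euclideanSpace, gaussianKL]
  ring_nf

end GaussianKL

section SampleStatistics

variable {d n : ℕ}

/-- The `i`-th coordinates of a sample `y` of size `n`, as a vector of `ℝⁿ`. -/
def coordRow (y : Fin n → EuclideanSpace ℝ (Fin d)) (i : Fin d) : EuclideanSpace ℝ (Fin n) :=
  WithLp.toLp 2 fun k => y k i

/-- The unit vector of `ℝⁿ` with equal coordinates. -/
noncomputable def unitDiagonal (n : ℕ) : EuclideanSpace ℝ (Fin n) :=
  WithLp.toLp 2 fun _ => 1 / √(n : ℝ)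

/-- The space of vectors of `ℝⁿ` whose coordinates sum to zero. -/
noncomputable abbrev centeredSpace (n : ℕ) : Submodule ℝ (EuclideanSpace ℝ (Fin n)) :=
  (ℝ ∙ unitDiagonal n)ᗮ

/-- The `i`-th coordinates of a sample, centered at their mean. -/
noncomputable def centeredRow (y : Fin n → EuclideanSpace ℝ (Fin d)) (i : Fin d) :
    centeredSpace n :=
  (centeredSpace n).orthogonalProjectionOnto (coordRow y i)

@[fun_prop]
lemma measurable_sampleMean :
    Measurable (sampleMean : (Fin n → EuclideanSpace ℝ (Fin d)) → EuclideanSpace ℝ (Fin d)) := by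
  unfold sampleMean
  fun_prop

@[fun_prop]
lemma measurable_centeredRow :
    Measurable (centeredRow : (Fin n → EuclideanSpace ℝ (Fin d)) → Fin d → centeredSpace n) := by
  unfold centeredRow coordRow
  fun_prop

lemma sum_inner_eq_sum_inner_coordRow (x y : Fin n → EuclideanSpace ℝ (Fin d)) :
    ∑ k, ⟪x k, y k⟫ = ∑ i, ⟪coordRow x i, coordRow y i⟫ := by
  simp only [PiLp.inner_apply, coordRow]
  exact Finset.sum_comm

lemma sampleMean_apply (y : Fin n → EuclideanSpace ℝ (Fin d)) (i : Fin d) :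
    sampleMean y i = (1 / (n : ℝ)) * ∑ k, y k i := by
  simp [sampleMean]

lemma norm_unitDiagonal (hn : n ≠ 0) : ‖unitDiagonal n‖ = 1 := by
  have hn' : (n : ℝ) ≠ 0 := by exact_mod_cast hn
  rw [← sq_eq_sq₀ (norm_nonneg _) zero_le_one, EuclideanSpace.real_norm_sq_eq]
  simp [unitDiagonal, hn']

lemma inner_unitDiagonal_coordRow (y : Fin n → EuclideanSpace ℝ (Fin d)) (i : Fin d) :
    ⟪unitDiagonal n, coordRow y i⟫ = √n * sampleMean y i := by
  have hs : √(n : ℝ) * (1 / n) = 1 / √n := by rw [mul_one_div, Real.sqrt_div_self']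
  rw [sampleMean_apply, ← mul_assoc, hs, PiLp.inner_apply, Finset.mul_sum]
  exact Finset.sum_congr rfl fun k _ => mul_comm _ _

lemma coe_centeredRow (hn : n ≠ 0) (y : Fin n → EuclideanSpace ℝ (Fin d)) (i : Fin d) :
    (centeredRow y i : EuclideanSpace ℝ (Fin n)) =
      coordRow y i - (√n * sampleMean y i) • unitDiagonal n := by
  rw [centeredRow, Submodule.coe_orthogonalProjectionOnto_apply,
    Submodule.starProjection_orthogonal_val,
    Submodule.starProjection_unit_singleton ℝ (norm_unitDiagonal hn), inner_unitDiagonal_coordRow]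

lemma sampleCov_eq_gram_centeredRow (hn : n ≠ 0) (y : Fin n → EuclideanSpace ℝ (Fin d)) :
    sampleCov y = (1 / (n : ℝ)) • gram ℝ (centeredRow y) := by
  have hn' : (0 : ℝ) < n := by positivity
  ext i j
  have hsum : ∑ k, y k i * y k j = ⟪coordRow y j, coordRow y i⟫ := rfl
  have hgram : ⟪centeredRow y i, centeredRow y j⟫ =
      ⟪coordRow y j, coordRow y i⟫ - n * (sampleMean y i * sampleMean y j) := by
    rw [Submodule.coe_inner, coe_centeredRow hn, coe_centeredRow hn, real_inner_comm]
    simp only [inner_sub_left, inner_sub_right, real_inner_smul_left, real_inner_smul_right,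
      inner_unitDiagonal_coordRow, real_inner_self_eq_norm_sq, norm_unitDiagonal hn,
      real_inner_comm (unitDiagonal n)]
    linear_combination -(sampleMean y i * sampleMean y j) * Real.mul_self_sqrt hn'.le
  rw [Matrix.smul_apply, Matrix.gram_apply, hgram, smul_eq_mul, mul_sub, ← mul_assoc,
    one_div_mul_cancel hn'.ne', one_mul, ← hsum]
  rfl

lemma sampleMean_affine (hn : n ≠ 0) (B : Matrix (Fin d) (Fin d) ℝ)
    (v : EuclideanSpace ℝ (Fin d)) (z : Fin n → EuclideanSpace ℝ (Fin d)) :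
    sampleMean (fun k => v + Matrix.toEuclideanCLM (𝕜 := ℝ) B (z k)) =
      v + Matrix.toEuclideanCLM (𝕜 := ℝ) B (sampleMean z) := by
  have hn' : (n : ℝ) ≠ 0 := by exact_mod_cast hn
  rw [sampleMean, sampleMean, map_smul, map_sum, Finset.sum_add_distrib, Finset.sum_const,
    Finset.card_univ, Fintype.card_fin, smul_add, ← Nat.cast_smul_eq_nsmul ℝ, smul_smul,
    one_div_mul_cancel hn', one_smul]

lemma centeredRow_affine (hn : n ≠ 0) (B : Matrix (Fin d) (Fin d) ℝ)
    (v : EuclideanSpace ℝ (Fin d)) (z : Fin n → EuclideanSpace ℝ (Fin d)) :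
    centeredRow (fun k => v + Matrix.toEuclideanCLM (𝕜 := ℝ) B (z k)) =
      fun i => ∑ j, B i j • centeredRow z j := by
  have hs : √(n : ℝ) ≠ 0 := by positivity
  ext i : 1
  have hrow : coordRow (fun k => v + Matrix.toEuclideanCLM (𝕜 := ℝ) B (z k)) i =
      (√n * v i) • unitDiagonal n + ∑ j, B i j • coordRow z j := by
    ext k
    simp [coordRow, unitDiagonal, Matrix.mulVec, dotProduct]
    field_simp
  have hdiag : (centeredSpace n).orthogonalProjectionOnto (unitDiagonal n) = 0 :=
    Submodule.orthogonalProjectionOnto_orthogonalComplement_singleton_eq_zero _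
  simp only [centeredRow]
  rw [hrow, map_add, map_smul, hdiag, smul_zero, zero_add, map_sum]
  simp_rw [map_smul]

lemma sampleCov_affine (hn : n ≠ 0) (B : Matrix (Fin d) (Fin d) ℝ)
    (v : EuclideanSpace ℝ (Fin d)) (z : Fin n → EuclideanSpace ℝ (Fin d)) :
    sampleCov (fun k => v + Matrix.toEuclideanCLM (𝕜 := ℝ) B (z k)) =
      (1 / (n : ℝ)) • (B * gram ℝ (centeredRow z) * Bᵀ) := by
  rw [sampleCov_eq_gram_centeredRow hn, centeredRow_affine hn, gram_sum_smul]

lemma finrank_centeredSpace (hn : n ≠ 0) : Module.finrank ℝ (centeredSpace n) + 1 = n := by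
  have h := Submodule.finrank_add_finrank_orthogonal (ℝ ∙ unitDiagonal n)
  rwa [finrank_span_singleton (norm_ne_zero_iff.1 (by simp [norm_unitDiagonal hn])),
    finrank_euclideanSpace_fin, add_comm] at h

lemma inner_sampleMean_add_sum_inner_centeredRow (z : Fin n → EuclideanSpace ℝ (Fin d))
    (h : EuclideanSpace ℝ (Fin d)) (t : Fin d → centeredSpace n) :
    ⟪√n • sampleMean z, h⟫ + ∑ i, ⟪centeredRow z i, t i⟫ =
      ∑ i, ⟪coordRow z i, h i • unitDiagonal n + t i⟫ := by
  rw [PiLp.inner_apply, ← Finset.sum_add_distrib]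
  refine Finset.sum_congr rfl fun i _ => ?_
  rw [inner_add_right, real_inner_smul_right, real_inner_comm (unitDiagonal n),
    inner_unitDiagonal_coordRow, centeredRow,
    Submodule.inner_orthogonalProjectionOnto_eq_of_mem_right]
  rfl

lemma norm_smul_unitDiagonal_add_sq (hn : n ≠ 0) (c : ℝ) (w : centeredSpace n) :
    ‖c • unitDiagonal n + w‖ ^ 2 = c ^ 2 + ‖w‖ ^ 2 := by
  have hw : ⟪unitDiagonal n, (w : EuclideanSpace ℝ (Fin n))⟫ = 0 :=
    Submodule.mem_orthogonal_singleton_iff_inner_right.1 w.2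
  rw [norm_add_sq_real, real_inner_smul_left, hw, norm_smul, norm_unitDiagonal hn]
  simp

end SampleStatistics

section SampleLaw

variable {d n : ℕ}

lemma map_fst_ofLp_snd_stdGaussian :
    (stdGaussian (WithLp 2 (EuclideanSpace ℝ (Fin d) × PiLp 2 fun _ : Fin d =>
      centeredSpace n))).map (fun q => (q.fst, q.snd.ofLp)) =
      (f d).prod (Measure.pi fun _ : Fin d => stdGaussian (centeredSpace n)) := by
  rw [← map_toLp_prod_stdGaussian, ← map_toLp_pi_stdGaussian (E := centeredSpace n),
    Measure.map_map (by fun_prop) (by fun_prop)]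
  change Measure.map (Prod.map id WithLp.ofLp) _ = _
  rw [← Measure.map_prod_map _ _ (by fun_prop) (by fun_prop), Measure.map_id,
    Measure.map_map (by fun_prop) (by fun_prop)]
  exact congrArg _ Measure.map_id

/-- The transpose of the map `z ↦ (√n • sampleMean z, centeredRow z)`. -/
noncomputable def sampleOfRows (q : WithLp 2 (EuclideanSpace ℝ (Fin d) × PiLp 2 fun _ : Fin d =>
    centeredSpace n)) : PiLp 2 fun _ : Fin n => EuclideanSpace ℝ (Fin d) :=
  WithLp.toLp 2 fun k => WithLp.toLp 2 fun i =>
    (q.fst i • unitDiagonal n + q.snd i : EuclideanSpace ℝ (Fin n)) k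

lemma coordRow_sampleOfRows (q : WithLp 2 (EuclideanSpace ℝ (Fin d) × PiLp 2 fun _ : Fin d =>
    centeredSpace n)) (i : Fin d) :
    coordRow (sampleOfRows q).ofLp i = q.fst i • unitDiagonal n + q.snd i :=
  rfl

lemma norm_sampleOfRows (hn : n ≠ 0) (q : WithLp 2 (EuclideanSpace ℝ (Fin d) ×
    PiLp 2 fun _ : Fin d => centeredSpace n)) : ‖sampleOfRows q‖ = ‖q‖ := by
  rw [← sq_eq_sq₀ (norm_nonneg _) (norm_nonneg _), ← real_inner_self_eq_norm_sq, PiLp.inner_apply,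
    sum_inner_eq_sum_inner_coordRow, WithLp.prod_norm_sq_eq_of_L2, EuclideanSpace.real_norm_sq_eq,
    PiLp.norm_sq_eq_of_L2, ← Finset.sum_add_distrib]
  refine Finset.sum_congr rfl fun i _ => ?_
  rw [coordRow_sampleOfRows, real_inner_self_eq_norm_sq, norm_smul_unitDiagonal_add_sq hn]

lemma map_sampleMean_centeredRow_stdGaussian (hn : n ≠ 0) :
    (Measure.pi fun _ : Fin n => f d).map (fun z => (√n • sampleMean z, centeredRow z)) =
      (f d).prod (Measure.pi fun _ : Fin d => stdGaussian (centeredSpace n)) := by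
  let T : PiLp 2 (fun _ : Fin n => EuclideanSpace ℝ (Fin d)) →
      WithLp 2 (EuclideanSpace ℝ (Fin d) × PiLp 2 fun _ : Fin d => centeredSpace n) :=
    fun z => WithLp.toLp 2 (√n • sampleMean z.ofLp, WithLp.toLp 2 (centeredRow z.ofLp))
  have hT : Measurable T := by fun_prop
  have hTS : ∀ z q, ⟪T z, q⟫ = ⟪z, sampleOfRows q⟫ := fun z q => by
    rw [WithLp.prod_inner_apply, PiLp.inner_apply z, sum_inner_eq_sum_inner_coordRow,
      PiLp.inner_apply (T z).ofLp.2]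
    exact inner_sampleMean_add_sum_inner_centeredRow z.ofLp q.fst q.snd.ofLp
  rw [← map_fst_ofLp_snd_stdGaussian,
    ← map_stdGaussian_of_adjoint_norm_eq hT hTS (norm_sampleOfRows hn), ← map_toLp_pi_stdGaussian,
    Measure.map_map (by fun_prop) (by fun_prop), Measure.map_map (by fun_prop) (by fun_prop)]
  rfl

lemma sqrt_smul {S : Matrix (Fin d) (Fin d) ℝ} (hS : S.PosDef) {c : ℝ} (hc : 0 ≤ c) :
    CFC.sqrt (c • S) = √c • CFC.sqrt S := by
  refine CFC.sqrt_unique ?_ (smul_nonneg (Real.sqrt_nonneg c) (CFC.sqrt_nonneg S))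
  rw [Matrix.smul_mul, Matrix.mul_smul, sqrt_mul_sqrt hS, smul_smul, Real.mul_self_sqrt hc]

lemma multivariateGaussian_smul_eq_map {S : Matrix (Fin d) (Fin d) ℝ} (hS : S.PosDef) {c : ℝ}
    (hc : 0 ≤ c) (v : EuclideanSpace ℝ (Fin d)) :
    multivariateGaussian v (c • S) =
      (f d).map fun x => v + Matrix.toEuclideanCLM (𝕜 := ℝ) (CFC.sqrt S) (√c • x) := by
  simp [multivariateGaussian, sqrt_smul hS hc]

lemma hasLaw_sampleMean_affine_centeredRow (hn : n ≠ 0) {S : Matrix (Fin d) (Fin d) ℝ}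
    (hS : S.PosDef) (v : EuclideanSpace ℝ (Fin d)) :
    HasLaw (fun z : Fin n → EuclideanSpace ℝ (Fin d) =>
      (sampleMean fun k => v + Matrix.toEuclideanCLM (𝕜 := ℝ) (CFC.sqrt S) (z k), centeredRow z))
      ((multivariateGaussian v ((1 / (n : ℝ)) • S)).prod
        (Measure.pi fun _ => stdGaussian (centeredSpace n))) (Measure.pi fun _ => f d) := by
  have hs : (√(n : ℝ))⁻¹ * √n = 1 := inv_mul_cancel₀ (by positivity)
  have hstat : (fun z : Fin n → EuclideanSpace ℝ (Fin d) =>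
      (sampleMean fun k => v + Matrix.toEuclideanCLM (𝕜 := ℝ) (CFC.sqrt S) (z k),
        centeredRow z)) =
      Prod.map (fun x => v + Matrix.toEuclideanCLM (𝕜 := ℝ) (CFC.sqrt S) (√(1 / n) • x)) id ∘
        fun z => (√n • sampleMean z, centeredRow z) := by
    ext1 z
    simp [sampleMean_affine hn, smul_smul, hs]
  refine ⟨by fun_prop, ?_⟩
  rw [hstat, ← Measure.map_map (by fun_prop) (by fun_prop),
    map_sampleMean_centeredRow_stdGaussian hn,
    ← Measure.map_prod_map _ _ (by fun_prop) (by fun_prop), Measure.map_id,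
    multivariateGaussian_smul_eq_map hS (by positivity)]

variable {Ω : Type*} [MeasurableSpace Ω] {P : Measure Ω}
  {Y : Fin n → Ω → EuclideanSpace ℝ (Fin d)} {S : Matrix (Fin d) (Fin d) ℝ}
  {v : EuclideanSpace ℝ (Fin d)}

lemma exists_hasLaw_sampleMean_sampleCov (hn : n ≠ 0) (hS : S.PosDef)
    (hlaw : ∀ k, HasLaw (Y k) (multivariateGaussian v S) P) (hindep : iIndepFun Y P) :
    ∃ X : Ω → Fin d → centeredSpace n,
      (∀ ω, sampleCov (fun k => Y k ω) =
        (1 / (n : ℝ)) • (CFC.sqrt S * gram ℝ (X ω) * CFC.sqrt S)) ∧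
      HasLaw (fun ω => (sampleMean fun k => Y k ω, X ω))
        ((multivariateGaussian v ((1 / (n : ℝ)) • S)).prod
          (Measure.pi fun _ => stdGaussian (centeredSpace n))) P := by
  set T := euclideanEquiv (CFC.sqrt S) (isUnit_det_sqrt hS)
  have : IsProbabilityMeasure P := (hlaw ⟨0, Nat.pos_of_ne_zero hn⟩).isProbabilityMeasure
  have hstd : HasLaw (fun y => T.symm (y - v)) (f d) (multivariateGaussian v S) := by
    refine ⟨by fun_prop, ?_⟩
    change Measure.map _ ((f d).map fun x => v + T x) = _
    rw [Measure.map_map (by fun_prop) (by fun_prop)]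
    simp [Function.comp_def]
  have hZ := (hindep.comp (fun _ y => T.symm (y - v)) fun _ => by fun_prop).hasLaw_pi
    fun k => hstd.fun_comp (hlaw k)
  have hYZ : ∀ ω, (fun k => Y k ω) = fun k =>
      v + Matrix.toEuclideanCLM (𝕜 := ℝ) (CFC.sqrt S) (T.symm (Y k ω - v)) := fun ω => by
    ext1 k
    change _ = v + T _
    simp
  refine ⟨fun ω => centeredRow fun k => T.symm (Y k ω - v), fun ω => ?_, ?_⟩
  · conv_lhs => rw [hYZ ω]
    rw [sampleCov_affine hn, transpose_sqrt]
  · convert (hasLaw_sampleMean_affine_centeredRow hn hS v).fun_comp hZ using 2 with ω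
    rw [hYZ ω]

end SampleLaw

section MeanGaussianKL

variable {ι : Type*} [Fintype ι] [DecidableEq ι]

lemma measurable_gaussianKL {α : Type*} [MeasurableSpace α] {m : α → ι → ℝ}
    {A : α → Matrix ι ι ℝ} (hm : Measurable m) (hA : ∀ i j, Measurable fun a => A a i j) :
    Measurable fun a => gaussianKL (m a) (A a) := by
  have hlog : Measurable fun a => Real.log (A a).det := (measurable_matrix_det hA).log
  have htrace : Measurable fun a => (A a)⁻¹.trace :=
    Finset.measurable_fun_sum _ fun i _ => measurable_matrix_inv hA i i
  have hquad : Measurable fun a => m a ⬝ᵥ (A a)⁻¹ *ᵥ m a := by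
    simp only [dotProduct_mulVec_eq_sum]
    exact Finset.measurable_fun_sum _ fun i _ => Finset.measurable_fun_sum _ fun j _ =>
      (measurable_matrix_inv hA i j).mul ((hm.eval (a := i)).mul (hm.eval (a := j)))
  exact (((hlog.sub_const _).add htrace).add hquad).div_const 2

/-- The mean of the Gaussian divergence `gaussianKL m A` when `m` is random with second moment
matrix `C - 1`. -/
noncomputable def meanGaussianKL (C A : Matrix ι ι ℝ) : ℝ :=
  (Real.log A.det - Fintype.card ι + (A⁻¹ * C).trace) / 2

variable {A T : Matrix ι ι ℝ} {v : EuclideanSpace ℝ ι}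

lemma integrable_gaussianKL (A : Matrix ι ι ℝ) :
    Integrable (fun m => gaussianKL m.ofLp A) (multivariateGaussian v T) :=
  ((integrable_const _).add (integrable_quadratic_multivariateGaussian A⁻¹)).div_const 2

lemma integral_gaussianKL (hT : T.PosSemidef) (A : Matrix ι ι ℝ) :
    ∫ m, gaussianKL m.ofLp A ∂(multivariateGaussian v T) =
      meanGaussianKL (1 + T + Matrix.vecMulVec v.ofLp v.ofLp) A := by
  simp only [gaussianKL]
  rw [integral_div, integral_add (integrable_const _) (integrable_quadratic_multivariateGaussian _),
    integral_quadratic_multivariateGaussian hT, meanGaussianKL, Matrix.mul_add, Matrix.mul_add,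
    Matrix.mul_one, Matrix.trace_add, Matrix.trace_add, Matrix.mul_vecMulVec,
    Matrix.trace_vecMulVec, dotProduct_comm]
  simp
  ring

lemma lintegral_gaussianKL (hT : T.PosSemidef) (hA : A.PosDef) :
    ∫⁻ m, ENNReal.ofReal (gaussianKL m.ofLp A) ∂(multivariateGaussian v T) =
      ENNReal.ofReal (meanGaussianKL (1 + T + Matrix.vecMulVec v.ofLp v.ofLp) A) := by
  rw [← integral_gaussianKL hT, ofReal_integral_eq_lintegral_ofReal (integrable_gaussianKL A)
    (.of_forall fun m => gaussianKL_nonneg m.ofLp hA)]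

lemma meanGaussianKL_nonneg (hT : T.PosSemidef) (hA : A.PosDef) (v : EuclideanSpace ℝ ι) :
    0 ≤ meanGaussianKL (1 + T + Matrix.vecMulVec v.ofLp v.ofLp) A := by
  rw [← integral_gaussianKL hT]
  exact integral_nonneg fun m => gaussianKL_nonneg m.ofLp hA

end MeanGaussianKL

section ScaledConjugate

variable {ι : Type*} [Fintype ι] {S G : Matrix ι ι ℝ} {c : ℝ}

open scoped Classical in
lemma posDef_smul_sqrt_mul_mul_sqrt (hS : S.PosDef) (hG : G.PosDef) (hc : 0 < c) :
    (c • (CFC.sqrt S * G * CFC.sqrt S)).PosDef := by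
  have h := hG.mul_mul_conjTranspose_same (B := CFC.sqrt S) (Matrix.vecMul_injective_iff_isUnit.2
    ((Matrix.isUnit_iff_isUnit_det _).2 (isUnit_det_sqrt hS)))
  rw [Matrix.conjTranspose_eq_transpose_of_trivial, transpose_sqrt] at h
  exact h.smul hc

variable [DecidableEq ι]

lemma log_det_smul_sqrt_mul_mul_sqrt (hS : S.PosDef) (hG : G.PosDef) (hc : 0 < c) :
    Real.log (c • (CFC.sqrt S * G * CFC.sqrt S)).det =
      Real.log S.det + Real.log G.det + Fintype.card ι * Real.log c := by
  have hdet : (CFC.sqrt S * G * CFC.sqrt S).det = S.det * G.det := by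
    rw [Matrix.det_mul, Matrix.det_mul, mul_right_comm, ← Matrix.det_mul, sqrt_mul_sqrt hS]
  rw [Matrix.det_smul, hdet, Real.log_mul (by positivity) (mul_pos hS.det_pos hG.det_pos).ne',
    Real.log_pow, Real.log_mul hS.det_pos.ne' hG.det_pos.ne', add_comm]

lemma trace_inv_smul_sqrt_mul_mul_sqrt (hc : c ≠ 0) (hS : S.PosDef) (hG : G.PosDef)
    (C : Matrix ι ι ℝ) :
    ((c • (CFC.sqrt S * G * CFC.sqrt S))⁻¹ * C).trace =
      c⁻¹ * ((CFC.sqrt S)⁻¹ * C * (CFC.sqrt S)⁻¹ * G⁻¹).trace := by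
  have hdet : IsUnit (CFC.sqrt S * G * CFC.sqrt S).det := by
    rw [Matrix.det_mul, Matrix.det_mul]
    exact ((isUnit_det_sqrt hS).mul hG.det_pos.ne'.isUnit).mul (isUnit_det_sqrt hS)
  rw [← Units.smul_mk0 hc, Matrix.inv_smul' _ _ hdet, Matrix.mul_inv_rev, Matrix.mul_inv_rev,
    Units.smul_def, Units.val_inv_eq_inv_val, Units.val_mk0, Matrix.smul_mul, Matrix.trace_smul,
    smul_eq_mul, Matrix.mul_assoc, Matrix.mul_assoc, Matrix.trace_mul_comm, Matrix.mul_assoc,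
    Matrix.trace_mul_comm]

lemma trace_inv_sqrt_mul_mul_inv_sqrt (hS : S.PosDef) (C : Matrix ι ι ℝ) :
    ((CFC.sqrt S)⁻¹ * C * (CFC.sqrt S)⁻¹).trace = (S⁻¹ * C).trace := by
  rw [Matrix.trace_mul_comm, ← Matrix.mul_assoc, ← Matrix.mul_inv_rev, sqrt_mul_sqrt hS]

lemma meanGaussianKL_smul_sqrt_mul_mul_sqrt (hS : S.PosDef) (hG : G.PosDef) (hc : 0 < c)
    (C : Matrix ι ι ℝ) :
    meanGaussianKL C (c • (CFC.sqrt S * G * CFC.sqrt S)) =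
      (Real.log S.det - Fintype.card ι + Fintype.card ι * Real.log c + Real.log G.det +
        c⁻¹ * ((CFC.sqrt S)⁻¹ * C * (CFC.sqrt S)⁻¹ * G⁻¹).trace) / 2 := by
  rw [meanGaussianKL, log_det_smul_sqrt_mul_mul_sqrt hS hG hc,
    trace_inv_smul_sqrt_mul_mul_sqrt hc.ne' hS hG]
  ring

end ScaledConjugate

section ExpectedKL

variable {d n : ℕ} {Ω : Type*} [MeasurableSpace Ω] {P : Measure Ω}
  {Y : Fin n → Ω → EuclideanSpace ℝ (Fin d)} {S : Matrix (Fin d) (Fin d) ℝ}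
  {v : EuclideanSpace ℝ (Fin d)}

lemma expectedKL_eq_lintegral_gaussianKL (hS : S.PosDef) (hdn : d + 1 ≤ n)
    (hlaw : ∀ k, HasLaw (Y k) (multivariateGaussian v S) P) (hindep : iIndepFun Y P) :
    expectedKL P Y =
      ∫⁻ x, ∫⁻ m, ENNReal.ofReal (gaussianKL m.ofLp
          ((1 / (n : ℝ)) • (CFC.sqrt S * gram ℝ x * CFC.sqrt S)))
        ∂(multivariateGaussian v ((1 / (n : ℝ)) • S))
        ∂(Measure.pi fun _ : Fin d => stdGaussian (centeredSpace n)) := by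
  have hn : n ≠ 0 := by omega
  have hfin := finrank_centeredSpace hn
  obtain ⟨X, hcov, hX⟩ := exists_hasLaw_sampleMean_sampleCov hn hS hlaw hindep
  have hli : ∀ᵐ q ∂((multivariateGaussian v ((1 / (n : ℝ)) • S)).prod
      (Measure.pi fun _ : Fin d => stdGaussian (centeredSpace n))), LinearIndependent ℝ q.2 :=
    Measure.quasiMeasurePreserving_snd.ae (ae_linearIndependent (by omega))
  have hmeas : Measurable fun q : EuclideanSpace ℝ (Fin d) × (Fin d → centeredSpace n) =>
      ENNReal.ofReal (gaussianKL q.1.ofLp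
        ((1 / (n : ℝ)) • (CFC.sqrt S * gram ℝ q.2 * CFC.sqrt S))) := by
    refine (measurable_gaussianKL (by fun_prop) fun i j => ?_).ennreal_ofReal
    simp only [Matrix.smul_apply, Matrix.mul_apply, Matrix.gram_apply]
    fun_prop
  rw [← lintegral_prod_symm _ hmeas.aemeasurable, ← hX.lintegral_comp hmeas.aemeasurable]
  refine lintegral_congr_ae ?_
  have hli' := (hX.ae_iff (p := fun q => LinearIndependent ℝ q.2) (measurableSet_setOfPred.1
    (measurableSet_linearIndependent.preimage measurable_snd))).2 hli
  filter_upwards [hli'] with ω hω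
  have hG : (gram ℝ (X ω)).PosDef := Matrix.posDef_gram_of_linearIndependent hω
  rw [gHat, hcov, klDiv_stdGaussian_multivariateGaussian _
    (posDef_smul_sqrt_mul_mul_sqrt hS hG (by positivity))]

lemma mul_trace_inv_sqrt_mul_mul_inv_sqrt (hS : S.PosDef) (hn : n ≠ 0) :
    n * ((CFC.sqrt S)⁻¹ * (1 + (1 / (n : ℝ)) • S + Matrix.vecMulVec v.ofLp v.ofLp) *
      (CFC.sqrt S)⁻¹).trace = n * (S⁻¹.trace + v.ofLp ⬝ᵥ S⁻¹ *ᵥ v.ofLp) + d := by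
  rw [trace_inv_sqrt_mul_mul_inv_sqrt hS, Matrix.mul_add, Matrix.mul_add, Matrix.mul_one,
    Matrix.mul_smul, Matrix.nonsing_inv_mul _ hS.det_pos.ne'.isUnit, Matrix.trace_add,
    Matrix.trace_add, Matrix.mul_vecMulVec, Matrix.trace_vecMulVec, dotProduct_comm,
    Matrix.trace_smul, Matrix.trace_one, Fintype.card_fin, smul_eq_mul]
  field_simp
  ring

lemma integral_meanGaussianKL_smul_sqrt_mul_gram_mul_sqrt (hS : S.PosDef) (hdn : d + 3 ≤ n)
    (C : Matrix (Fin d) (Fin d) ℝ) :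
    Integrable (fun x => meanGaussianKL C
        ((1 / (n : ℝ)) • (CFC.sqrt S * gram ℝ x * CFC.sqrt S)))
      (Measure.pi fun _ : Fin d => stdGaussian (centeredSpace n)) ∧
    ∫ x, meanGaussianKL C ((1 / (n : ℝ)) • (CFC.sqrt S * gram ℝ x * CFC.sqrt S))
        ∂(Measure.pi fun _ : Fin d => stdGaussian (centeredSpace n)) =
      (Real.log S.det - d - d * Real.log n + (∫ x, Real.log (gram ℝ x).det
          ∂(Measure.pi fun _ : Fin d => stdGaussian (centeredSpace n))) +
        n * ((CFC.sqrt S)⁻¹ * C * (CFC.sqrt S)⁻¹).trace / (n - d - 2)) / 2 := by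
  have hfin := finrank_centeredSpace (show n ≠ 0 by omega)
  have hfin' : (Module.finrank ℝ (centeredSpace n) : ℝ) = n - 1 :=
    eq_sub_of_add_eq (by exact_mod_cast hfin)
  have hpos : (0 : ℝ) < 1 / n := one_div_pos.2 (by exact_mod_cast (by omega : 0 < n))
  set μ := Measure.pi fun _ : Fin d => stdGaussian (centeredSpace n)
  set M := (CFC.sqrt S)⁻¹ * C * (CFC.sqrt S)⁻¹
  have hlog : Integrable (fun x => Real.log (gram ℝ x).det) μ := integrable_log_det_gram (by omega)
  have htrace : Integrable (fun x => (M * (gram ℝ x)⁻¹).trace) μ :=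
    integrable_trace_mul_inv_gram (by omega) M
  have hsum : Integrable (fun x => Real.log S.det - d - d * Real.log n +
      Real.log (gram ℝ x).det) μ := (integrable_const _).add hlog
  have heq : (fun x => meanGaussianKL C ((1 / (n : ℝ)) • (CFC.sqrt S * gram ℝ x * CFC.sqrt S)))
      =ᵐ[μ] fun x => (Real.log S.det - d - d * Real.log n + Real.log (gram ℝ x).det +
        n * (M * (gram ℝ x)⁻¹).trace) / 2 := by
    filter_upwards [ae_posDef_gram (by omega)] with x hx
    rw [meanGaussianKL_smul_sqrt_mul_mul_sqrt hS hx hpos, Fintype.card_fin, one_div, Real.log_inv,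
      inv_inv]
    ring
  refine ⟨((hsum.add (htrace.const_mul n)).div_const 2).congr heq.symm, ?_⟩
  rw [integral_congr_ae heq, integral_div, integral_add hsum (htrace.const_mul n),
    integral_add (integrable_const _) hlog, integral_const_mul,
    integral_trace_mul_inv_gram (by omega), hfin', integral_const, probReal_univ, one_smul]
  ring

lemma expectedKL_eq (hS : S.PosDef) (hdn : d + 3 ≤ n)
    (hlaw : ∀ k, HasLaw (Y k) (multivariateGaussian v S) P) (hindep : iIndepFun Y P) :
    expectedKL P Y = ENNReal.ofReal ((Real.log S.det - d - d * Real.log n +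
      (∫ x, Real.log (gram ℝ x).det
        ∂(Measure.pi fun _ : Fin d => stdGaussian (centeredSpace n))) +
      (n * (S⁻¹.trace + v.ofLp ⬝ᵥ S⁻¹ *ᵥ v.ofLp) + d) / (n - d - 2)) / 2) := by
  have hn : n ≠ 0 := by omega
  have hfin := finrank_centeredSpace hn
  have hpos : (0 : ℝ) < 1 / n := by positivity
  have hT : ((1 / (n : ℝ)) • S).PosSemidef := (hS.smul hpos).posSemidef
  have hposDef : ∀ᵐ x ∂(Measure.pi fun _ : Fin d => stdGaussian (centeredSpace n)),
      ((1 / (n : ℝ)) • (CFC.sqrt S * gram ℝ x * CFC.sqrt S)).PosDef := by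
    filter_upwards [ae_posDef_gram (by omega)] with x hx
    exact posDef_smul_sqrt_mul_mul_sqrt hS hx hpos
  obtain ⟨hint, hmean⟩ := integral_meanGaussianKL_smul_sqrt_mul_gram_mul_sqrt hS hdn
    (1 + (1 / (n : ℝ)) • S + Matrix.vecMulVec v.ofLp v.ofLp)
  rw [expectedKL_eq_lintegral_gaussianKL hS (by omega) hlaw hindep,
    ← mul_trace_inv_sqrt_mul_mul_inv_sqrt hS hn, ← hmean,
    ofReal_integral_eq_lintegral_ofReal hint]
  · refine lintegral_congr_ae ?_
    filter_upwards [hposDef] with x hx using lintegral_gaussianKL hT hx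
  · filter_upwards [hposDef] with x hx using meanGaussianKL_nonneg hT hx v

end ExpectedKL

section LoewnerLowerBound

variable {ι : Type*} [DecidableEq ι] {S : Matrix ι ι ℝ} {c : ℝ}

lemma posDef_of_smul_one_le [Finite ι] (hc : 0 < c) (hS : c • 1 ≤ S) : S.PosDef := by
  simpa using (Matrix.PosDef.one.smul hc).add_posSemidef (Matrix.le_iff.1 hS)

variable [Fintype ι]

lemma inv_le_inv_smul_one (hc : 0 < c) (hS : c • 1 ≤ S) : S⁻¹ ≤ c⁻¹ • 1 := by
  have hpos := posDef_of_smul_one_le hc hS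
  have hunit := isUnit_det_sqrt hpos
  have hsymm : (CFC.sqrt S)⁻¹ᵀ = (CFC.sqrt S)⁻¹ := by
    rw [Matrix.transpose_nonsing_inv, transpose_sqrt]
  have hconj : (CFC.sqrt S)⁻¹ * (S - c • 1) * (CFC.sqrt S)⁻¹ = 1 - c • S⁻¹ := by
    rw [Matrix.mul_sub, Matrix.sub_mul, Matrix.mul_smul, Matrix.mul_one, Matrix.smul_mul,
      ← Matrix.mul_inv_rev, sqrt_mul_sqrt hpos]
    congr 1
    nth_rw 2 [← sqrt_mul_sqrt hpos]
    rw [← Matrix.mul_assoc, Matrix.nonsing_inv_mul _ hunit, Matrix.one_mul,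
      Matrix.mul_nonsing_inv _ hunit]
  have h := (Matrix.le_iff.1 hS).mul_mul_conjTranspose_same (CFC.sqrt S)⁻¹
  rw [Matrix.conjTranspose_eq_transpose_of_trivial, hsymm, hconj] at h
  rw [Matrix.le_iff]
  simpa [smul_sub, smul_smul, hc.ne'] using h.smul (inv_nonneg.2 hc.le)

lemma trace_inv_le (hc : 0 < c) (hS : c • 1 ≤ S) : S⁻¹.trace ≤ Fintype.card ι / c := by
  have h := (Matrix.le_iff.1 (inv_le_inv_smul_one hc hS)).trace_nonneg
  rw [Matrix.trace_sub, Matrix.trace_smul, Matrix.trace_one, smul_eq_mul] at h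
  rw [div_eq_inv_mul]
  exact sub_nonneg.1 h

lemma dotProduct_inv_mulVec_le (hc : 0 < c) (hS : c • 1 ≤ S) (x : ι → ℝ) :
    x ⬝ᵥ S⁻¹ *ᵥ x ≤ x ⬝ᵥ x / c := by
  have h := (Matrix.le_iff.1 (inv_le_inv_smul_one hc hS)).dotProduct_mulVec_nonneg x
  rw [star_trivial, Matrix.sub_mulVec, Matrix.smul_mulVec, Matrix.one_mulVec, dotProduct_sub,
    dotProduct_smul, smul_eq_mul] at h
  rw [div_eq_inv_mul]
  exact sub_nonneg.1 h

lemma log_det_add_trace_inv_sub_card_le (hc : 0 < c) (hS : c • 1 ≤ S) :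
    Real.log S.det + S⁻¹.trace - Fintype.card ι ≤ ((S - 1) * (S - 1)).trace / c := by
  have hpos := posDef_of_smul_one_le hc hS
  have hunit := hpos.det_pos.ne'.isUnit
  have hlog := log_det_le_trace_sub_card hpos
  have hsub : (S - 1)ᴴ = S - 1 := by
    rw [Matrix.conjTranspose_sub, hpos.1.eq, Matrix.conjTranspose_one]
  have hexpand : ((S - 1) * S⁻¹ * (S - 1)).trace = S.trace + S⁻¹.trace - 2 * Fintype.card ι := by
    rw [Matrix.sub_mul, Matrix.mul_nonsing_inv _ hunit, Matrix.one_mul, Matrix.sub_mul,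
      Matrix.one_mul, Matrix.mul_sub, Matrix.nonsing_inv_mul _ hunit, Matrix.mul_one]
    simp only [Matrix.trace_sub, Matrix.trace_one]
    ring
  have h := ((Matrix.le_iff.1 (inv_le_inv_smul_one hc hS)).mul_mul_conjTranspose_same
    (S - 1)).trace_nonneg
  rw [hsub, Matrix.mul_sub (S - 1), Matrix.sub_mul, Matrix.mul_smul, Matrix.mul_one,
    Matrix.smul_mul, Matrix.trace_sub, Matrix.trace_smul, smul_eq_mul, hexpand] at h
  rw [div_eq_inv_mul]
  linarith

lemma le_trace_inv (hS : S.PosDef) :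
    3 / 4 * Fintype.card ι - ((S - 1) * (S - 1)).trace ≤ S⁻¹.trace := by
  have hlog := (card_sub_trace_inv_le_log_det hS).trans (log_det_le_trace_sub_card hS)
  have hsymm : (S - (3 / 2 : ℝ) • 1)ᴴ = S - (3 / 2 : ℝ) • 1 := by
    rw [Matrix.conjTranspose_sub, hS.1.eq, Matrix.conjTranspose_smul, Matrix.conjTranspose_one,
      star_trivial]
  have h := (Matrix.posSemidef_conjTranspose_mul_self (S - (3 / 2 : ℝ) • 1)).trace_nonneg
  rw [hsymm] at h
  simp only [Matrix.sub_mul, Matrix.mul_sub, Matrix.smul_mul, Matrix.mul_smul, Matrix.one_mul,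
    Matrix.mul_one, Matrix.trace_sub, Matrix.trace_smul, Matrix.trace_one, smul_eq_mul] at h ⊢
  linarith

end LoewnerLowerBound

section ExpectedKLBounds

variable {d n : ℕ}

lemma sum_range_log_sub_ge (hd : d + 3 ≤ n) :
    -((d ^ 2 + 5 * d) / (2 * (n - d - 2)) : ℝ) ≤
      ∑ i ∈ Finset.range d, Real.log (n - i - 3 : ℝ) - d * Real.log n := by
  have hdn : (d + 3 : ℝ) ≤ n := by exact_mod_cast hd
  have hgap : (0 : ℝ) < n - d - 2 := by linarith
  have hterm : ∀ i ∈ Finset.range d, -((i + 3 : ℝ) / (n - d - 2)) ≤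
      Real.log (n - i - 3 : ℝ) - Real.log n := by
    intro i hi
    have hi' : (i + 1 : ℝ) ≤ d := by exact_mod_cast Finset.mem_range.1 hi
    have hpos : (0 : ℝ) < n - i - 3 := by linarith
    have hn0 : (0 : ℝ) < n := by linarith [(Nat.cast_nonneg i : (0 : ℝ) ≤ i)]
    calc -((i + 3 : ℝ) / (n - d - 2)) ≤ -((i + 3 : ℝ) / (n - i - 3)) := by
          have := div_le_div_of_nonneg_left (by positivity : (0 : ℝ) ≤ i + 3) hgap
            (by linarith : (n - d - 2 : ℝ) ≤ n - i - 3)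
          linarith
      _ = 1 - ((n - i - 3 : ℝ) / n)⁻¹ := by
          field_simp
          ring
      _ ≤ Real.log ((n - i - 3 : ℝ) / n) := Real.one_sub_inv_le_log_of_pos (div_pos hpos hn0)
      _ = _ := Real.log_div hpos.ne' hn0.ne'
  have hsum : ∀ e : ℕ, ∑ i ∈ Finset.range e, (i + 3 : ℝ) = (e ^ 2 + 5 * e) / 2 := by
    intro e
    induction e with
    | zero => simp
    | succ e ih =>
      rw [Finset.sum_range_succ, ih]
      push_cast
      ring
  have h := Finset.sum_le_sum hterm
  rwa [Finset.sum_neg_distrib, ← Finset.sum_div, Finset.sum_sub_distrib, Finset.sum_const,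
    Finset.card_range, nsmul_eq_mul, hsum, div_div] at h

lemma integral_log_det_gram_centeredSpace_le (hdn : d + 3 ≤ n) :
    ∫ x, Real.log (gram ℝ x).det
      ∂(Measure.pi fun _ : Fin d => stdGaussian (centeredSpace n)) ≤ d * Real.log n := by
  have hfin := finrank_centeredSpace (show n ≠ 0 by omega)
  refine (integral_log_det_gram_le (by omega)).trans ?_
  gcongr
  · exact_mod_cast (by omega : 0 < Module.finrank ℝ (centeredSpace n))
  · omega

lemma le_integral_log_det_gram_centeredSpace (hdn : d + 3 ≤ n) :
    -((d ^ 2 + 5 * d) / (2 * (n - d - 2)) : ℝ) ≤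
      (∫ x, Real.log (gram ℝ x).det
        ∂(Measure.pi fun _ : Fin d => stdGaussian (centeredSpace n))) - d * Real.log n := by
  have hfin := finrank_centeredSpace (show n ≠ 0 by omega)
  have hfin' : (Module.finrank ℝ (centeredSpace n) : ℝ) = n - 1 :=
    eq_sub_of_add_eq (by exact_mod_cast hfin)
  refine (sum_range_log_sub_ge hdn).trans (sub_le_sub_right ?_ _)
  refine le_trans (Finset.sum_le_sum fun i _ => ?_) (sum_log_le_integral_log_det_gram (by omega))
  rw [hfin']
  exact le_of_eq (by ring_nf)

variable {Ω : Type*} [MeasurableSpace Ω] {P : Measure Ω}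
  {Y : Fin n → Ω → EuclideanSpace ℝ (Fin d)} {S : Matrix (Fin d) (Fin d) ℝ}
  {v : EuclideanSpace ℝ (Fin d)} {c K M : ℝ}

lemma expectedKL_le (hc : 0 < c) (hS : c • 1 ≤ S) (hK : ((S - 1) * (S - 1)).trace ≤ K)
    (hM : ‖v‖ ^ 2 ≤ M) (hdn : d + 3 ≤ n)
    (hlaw : ∀ k, HasLaw (Y k) (multivariateGaussian v S) P) (hindep : iIndepFun Y P) :
    expectedKL P Y ≤ ENNReal.ofReal
      ((K / c + ((d + 2) * (d / c) + n * (M / c) + d) / (n - d - 2)) / 2) := by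
  rw [expectedKL_eq (posDef_of_smul_one_le hc hS) hdn hlaw hindep]
  have hgap : (0 : ℝ) < n - d - 2 := by
    have : (d + 3 : ℝ) ≤ n := by exact_mod_cast hdn
    linarith
  have hspec := (log_det_add_trace_inv_sub_card_le hc hS).trans
    (div_le_div_of_nonneg_right hK hc.le)
  have htrace := trace_inv_le hc hS
  rw [Fintype.card_fin] at hspec htrace
  have hquad : v.ofLp ⬝ᵥ S⁻¹ *ᵥ v.ofLp ≤ M / c := by
    refine (dotProduct_inv_mulVec_le hc hS v.ofLp).trans (div_le_div_of_nonneg_right ?_ hc.le)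
    rwa [dotProduct, ← Finset.sum_congr rfl fun i _ => sq (v i), ← EuclideanSpace.real_norm_sq_eq]
  have hlog := integral_log_det_gram_centeredSpace_le hdn
  have hfrac : (n * (S⁻¹.trace + v.ofLp ⬝ᵥ S⁻¹ *ᵥ v.ofLp) + d) / (n - d - 2 : ℝ) =
      S⁻¹.trace + ((d + 2) * S⁻¹.trace + n * (v.ofLp ⬝ᵥ S⁻¹ *ᵥ v.ofLp) + d) / (n - d - 2) := by
    field_simp
    ring
  have hfrac_le : ((d + 2) * S⁻¹.trace + n * (v.ofLp ⬝ᵥ S⁻¹ *ᵥ v.ofLp) + d) / (n - d - 2 : ℝ) ≤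
      ((d + 2) * (d / c) + n * (M / c) + d) / (n - d - 2) := by
    gcongr
  rw [hfrac]
  exact ENNReal.ofReal_le_ofReal (by linarith)

lemma le_expectedKL (hS : S.PosDef) (hK : ((S - 1) * (S - 1)).trace ≤ K) (hdn : d + 3 ≤ n)
    (hlaw : ∀ k, HasLaw (Y k) (multivariateGaussian v S) P) (hindep : iIndepFun Y P) :
    ENNReal.ofReal ((d ^ 2 / 4 - K * (d + 2)) / (n - d - 2) / 2) ≤ expectedKL P Y := by
  rw [expectedKL_eq hS hdn hlaw hindep]
  have hgap : (0 : ℝ) < n - d - 2 := by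
    have : (d + 3 : ℝ) ≤ n := by exact_mod_cast hdn
    linarith
  have hspec := card_sub_trace_inv_le_log_det hS
  have htrace := le_trace_inv hS
  rw [Fintype.card_fin] at hspec htrace
  have hquad : 0 ≤ v.ofLp ⬝ᵥ S⁻¹ *ᵥ v.ofLp := by
    simpa using hS.inv.posSemidef.dotProduct_mulVec_nonneg v.ofLp
  have hlog := le_integral_log_det_gram_centeredSpace hdn
  have hfrac : S⁻¹.trace + ((d + 2) * (3 / 4 * d - K) + d) / (n - d - 2 : ℝ) ≤
      (n * (S⁻¹.trace + v.ofLp ⬝ᵥ S⁻¹ *ᵥ v.ofLp) + d) / (n - d - 2) :=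
    calc _ ≤ S⁻¹.trace + ((d + 2) * S⁻¹.trace + d) / (n - d - 2 : ℝ) := by
          gcongr
          linarith
      _ = (n * (S⁻¹.trace + 0) + d) / (n - d - 2) := by
          field_simp
          ring
      _ ≤ _ := by gcongr
  have hsum : (d ^ 2 / 4 - K * (d + 2)) / (n - d - 2 : ℝ) =
      -((d ^ 2 + 5 * d) / (2 * (n - d - 2))) + ((d + 2) * (3 / 4 * d - K) + d) / (n - d - 2) := by
    field_simp
    ring
  rw [hsum]
  exact ENNReal.ofReal_le_ofReal (by linarith)

end ExpectedKLBounds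

section BoundedDensity

variable {α : Type*} [MeasurableSpace α] {μ ν : Measure α} {C : NNReal}

lemma one_le_of_le_smul [IsProbabilityMeasure μ] [IsProbabilityMeasure ν] (hν : ν ≤ C • μ) :
    1 ≤ C := by
  simpa using hν Set.univ

lemma memLp_of_le_smul {G : Type*} [NormedAddCommGroup G] {h : α → G} {p : ℝ≥0∞}
    (hν : ν ≤ C • μ) (hh : MemLp h p μ) : MemLp h p ν :=
  hh.of_measure_le_smul ENNReal.coe_ne_top hν

lemma sq_integral_sub_integral_le [IsProbabilityMeasure μ] [IsProbabilityMeasure ν] {h : α → ℝ}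
    (hν : ν ≤ C • μ) (hh : MemLp h 2 μ) : (∫ x, h x ∂ν - ∫ x, h x ∂μ) ^ 2 ≤ C * Var[h; μ] := by
  set g : α → ℝ := fun x => h x - ∫ y, h y ∂μ
  have hgμ : MemLp g 2 μ := hh.sub (memLp_const _)
  have hgν : MemLp g 2 ν := memLp_of_le_smul hν hgμ
  calc (∫ x, h x ∂ν - ∫ x, h x ∂μ) ^ 2 = (∫ x, g x ∂ν) ^ 2 := by
        rw [integral_sub ((memLp_of_le_smul hν hh).integrable one_le_two) (integrable_const _),
          integral_const, probReal_univ, one_smul]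
    _ ≤ ∫ x, g x ^ 2 ∂ν := by
        have := variance_nonneg g ν
        rw [variance_eq_sub hgν] at this
        exact sub_nonneg.1 this
    _ ≤ ∫ x, g x ^ 2 ∂(C • μ) :=
        integral_mono_measure hν (.of_forall fun x => sq_nonneg _)
          (hgμ.integrable_sq.smul_measure ENNReal.coe_ne_top)
    _ = C * Var[h; μ] := by
        rw [integral_smul_nnreal_measure, variance_eq_integral hh.aemeasurable]
        rfl

lemma inv_sq_le_variance_of_le_smul_volume {ρ : Measure ℝ} [IsProbabilityMeasure ρ] {L : NNReal}
    (hρ : ρ ≤ L • volume) (h2 : MemLp id 2 ρ) : (32 * L ^ 2 : ℝ)⁻¹ ≤ Var[id; ρ] := by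
  rcases eq_zero_or_pos L with rfl | hL
  · simp [variance_nonneg]
  have hL' : (0 : ℝ) < L := hL
  set r : ℝ := (4 * L)⁻¹ with hr
  have hr0 : 0 < r := by positivity
  have hball : ρ.real (Metric.ball (∫ x, x ∂ρ) r) ≤ 1 / 2 := by
    refine ENNReal.toReal_le_of_le_ofReal (by norm_num) ((hρ _).trans_eq ?_)
    rw [Measure.smul_apply, Real.volume_ball, ENNReal.smul_def, smul_eq_mul,
      ← ENNReal.ofReal_coe_nnreal, ← ENNReal.ofReal_mul hL'.le, hr]
    congr 1
    field_simp
    norm_num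
  have htail : ρ.real (Metric.ball (∫ x, x ∂ρ) r)ᶜ ≤ Var[id; ρ] / r ^ 2 := by
    refine ENNReal.toReal_le_of_le_ofReal (by have := variance_nonneg id ρ; positivity) ?_
    convert meas_ge_le_variance_div_sq h2 hr0 using 2
    ext x
    simp [Real.dist_eq]
  rw [probReal_compl_eq_one_sub measurableSet_ball] at htail
  have hvar : 1 / 2 * r ^ 2 ≤ Var[id; ρ] := (le_div_iff₀ (by positivity)).1 (by linarith)
  refine le_of_eq_of_le ?_ hvar
  rw [hr]
  field_simp
  norm_num

lemma gaussianReal_le_smul_volume (m : ℝ) {v : NNReal} (hv : v ≠ 0) :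
    gaussianReal m v ≤ (√(2 * Real.pi * v))⁻¹.toNNReal • volume := by
  calc gaussianReal m v = volume.withDensity (gaussianPDF m v) := gaussianReal_of_var_ne_zero m hv
    _ ≤ volume.withDensity fun _ => ENNReal.ofReal (√(2 * Real.pi * v))⁻¹ := by
        refine withDensity_mono (.of_forall fun x => ENNReal.ofReal_le_ofReal ?_)
        exact mul_le_of_le_one_right (by positivity) (Real.exp_le_one_iff.2
          (div_nonpos_of_nonpos_of_nonneg (neg_nonpos.2 (sq_nonneg _)) (by positivity)))
    _ = (√(2 * Real.pi * v))⁻¹.toNNReal • volume := withDensity_const _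

end BoundedDensity

section StdGaussianBoundedDensity

variable {E : Type*} [NormedAddCommGroup E] [InnerProductSpace ℝ E] [FiniteDimensional ℝ E]
  [MeasurableSpace E] [BorelSpace E] {ν : Measure E} {C : NNReal}

lemma memLp_inner_stdGaussian (u : E) : MemLp (fun x => ⟪u, x⟫) 2 (stdGaussian E) :=
  IsGaussian.memLp_two_id.const_inner u

lemma variance_inner_stdGaussian (u : E) : Var[fun x => ⟪u, x⟫; stdGaussian E] = ‖u‖ ^ 2 := by
  rw [← variance_id_map (by fun_prop), map_inner_stdGaussian, variance_id_gaussianReal,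
    Real.coe_toNNReal _ (sq_nonneg _)]

lemma integral_inner_stdGaussian (u : E) : ∫ x, ⟪u, x⟫ ∂(stdGaussian E) = 0 := by
  have hint : Integrable (fun x : E => x) (stdGaussian E) :=
    IsGaussian.memLp_two_id.integrable one_le_two
  rw [integral_inner hint, integral_id_stdGaussian, inner_zero_right]

variable [IsProbabilityMeasure ν]

lemma norm_integral_id_sq_le (hν : ν ≤ C • stdGaussian E) : ‖∫ x, x ∂ν‖ ^ 2 ≤ C := by
  set m := ∫ x, x ∂ν with hm
  have hint : Integrable (fun x => x) ν :=
    (memLp_of_le_smul hν IsGaussian.memLp_two_id).integrable one_le_two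
  have h := sq_integral_sub_integral_le hν (memLp_inner_stdGaussian m)
  rw [integral_inner_stdGaussian, variance_inner_stdGaussian, integral_inner hint, ← hm,
    real_inner_self_eq_norm_sq, sub_zero, sq (‖m‖ ^ 2)] at h
  rcases (sq_nonneg ‖m‖).eq_or_lt with h0 | h0
  · exact h0 ▸ C.coe_nonneg
  · exact le_of_mul_le_mul_right h h0

lemma le_variance_inner (hν : ν ≤ C • stdGaussian E) (u : E) :
    Real.pi / (16 * C ^ 2) * ‖u‖ ^ 2 ≤ Var[fun x => ⟪u, x⟫; ν] := by
  rcases eq_or_ne u 0 with rfl | hu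
  · simp
  set v : NNReal := (‖u‖ ^ 2).toNNReal with hv
  have hv0 : v ≠ 0 := by positivity
  have hproj : Measurable fun x : E => ⟪u, x⟫ := by fun_prop
  have := Measure.isProbabilityMeasure_map (μ := ν) hproj.aemeasurable
  have hle : ν.map (fun x => ⟪u, x⟫) ≤ (C * (√(2 * Real.pi * v))⁻¹.toNNReal) • volume := by
    calc ν.map (fun x => ⟪u, x⟫) ≤ (C • stdGaussian E).map (fun x => ⟪u, x⟫) :=
          Measure.map_mono hν hproj
      _ = C • gaussianReal 0 v := by rw [Measure.map_smul, map_inner_stdGaussian]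
      _ ≤ _ := by
          rw [mul_smul]
          gcongr
          exact gaussianReal_le_smul_volume 0 hv0
  have hmem : MemLp id 2 (ν.map fun x => ⟪u, x⟫) :=
    (memLp_map_measure_iff (by fun_prop) hproj.aemeasurable).2
      (memLp_of_le_smul hν (memLp_inner_stdGaussian u))
  have h := inv_sq_le_variance_of_le_smul_volume hle hmem
  rw [variance_id_map hproj.aemeasurable] at h
  refine le_of_eq_of_le ?_ h
  rw [NNReal.coe_mul, Real.coe_toNNReal _ (by positivity), mul_pow, inv_pow,
    Real.sq_sqrt (by positivity), hv, Real.coe_toNNReal _ (sq_nonneg _)]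
  field_simp [Real.pi_ne_zero]
  norm_num

end StdGaussianBoundedDensity

section SecondMoments

variable {E ι : Type*} [Fintype ι] [NormedAddCommGroup E] [InnerProductSpace ℝ E]
  [FiniteDimensional ℝ E] [MeasurableSpace E] [BorelSpace E] {ν : Measure E} {C : NNReal}

lemma map_inner_orthonormalBasis_stdGaussian (b : OrthonormalBasis ι ℝ E) :
    (stdGaussian E).map (fun x i => ⟪b i, x⟫) = Measure.pi fun _ => gaussianReal 0 1 := by
  rw [stdGaussian_eq_map_pi_orthonormalBasis b, Measure.map_map (by fun_prop) (by fun_prop)]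
  convert Measure.map_id using 2
  ext x i
  exact b.orthonormal.inner_right_fintype x i

lemma memLp_inner_sq_of_isGaussian {μ : Measure E} [IsGaussian μ] (u : E) :
    MemLp (fun x => ⟪u, x⟫ ^ 2) 2 μ := by
  have h4 : MemLp (fun x => ⟪u, x⟫) 4 μ :=
    (IsGaussian.memLp_id μ 4 (by norm_num)).const_inner u
  rw [memLp_two_iff_integrable_sq (by fun_prop)]
  simp_rw [← pow_mul]
  simpa [Even.pow_abs ⟨2, rfl⟩] using h4.integrable_norm_pow (p := 4) (by norm_num)

lemma variance_sum_mul_inner_sq_stdGaussian (b : OrthonormalBasis ι ℝ E) (t : ι → ℝ) :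
    Var[fun x => ∑ i, t i * ⟪b i, x⟫ ^ 2; stdGaussian E] =
      (∑ i, t i ^ 2) * Var[fun x => x ^ 2; gaussianReal 0 1] := by
  have hproj : Measurable fun (x : E) i => ⟪b i, x⟫ := by fun_prop
  calc Var[fun x => ∑ i, t i * ⟪b i, x⟫ ^ 2; stdGaussian E]
      = Var[∑ i, fun y : ι → ℝ => t i * y i ^ 2; (stdGaussian E).map fun x i => ⟪b i, x⟫] := by
        rw [variance_map (Measurable.aemeasurable (by fun_prop)) hproj.aemeasurable]
        congr 1
        ext x
        simp
    _ = ∑ i, Var[fun x => t i * x ^ 2; gaussianReal 0 1] := by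
        rw [map_inner_orthonormalBasis_stdGaussian]
        refine variance_sum_pi (X := fun i x => t i * x ^ 2) fun i => ?_
        simpa using (memLp_inner_sq_of_isGaussian (μ := gaussianReal 0 1) 1).const_mul (t i)
    _ = (∑ i, t i ^ 2) * Var[fun x => x ^ 2; gaussianReal 0 1] := by
        simp_rw [variance_const_mul, Finset.sum_mul]

variable [IsProbabilityMeasure ν]

-- Testing against the quadratic form whose coefficients are the deviations themselves.
lemma sum_sq_integral_inner_sq_sub_one_le (hν : ν ≤ C • stdGaussian E)
    (b : OrthonormalBasis ι ℝ E) :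
    ∑ i, (∫ x, ⟪b i, x⟫ ^ 2 ∂ν - 1) ^ 2 ≤ C * Var[fun x => x ^ 2; gaussianReal 0 1] := by
  set t : ι → ℝ := fun i => ∫ x, ⟪b i, x⟫ ^ 2 ∂ν - 1
  have hmem : ∀ i, MemLp (fun x => t i * ⟪b i, x⟫ ^ 2) 2 (stdGaussian E) := fun i =>
    (memLp_inner_sq_of_isGaussian (b i)).const_mul (t i)
  have hdiff : ∫ x, ∑ i, t i * ⟪b i, x⟫ ^ 2 ∂ν - ∫ x, ∑ i, t i * ⟪b i, x⟫ ^ 2 ∂(stdGaussian E) =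
      ∑ i, t i ^ 2 := by
    rw [integral_finsetSum _ fun i _ => (memLp_of_le_smul hν (hmem i)).integrable one_le_two,
      integral_finsetSum _ fun i _ => (hmem i).integrable one_le_two]
    simp_rw [integral_const_mul, integral_inner_sq_stdGaussian, b.norm_eq_one, one_pow,
      ← Finset.sum_sub_distrib, ← mul_sub, sq (t _)]
    rfl
  have h := sq_integral_sub_integral_le hν (memLp_finsetSum Finset.univ fun i _ => hmem i)
  rw [hdiff, variance_sum_mul_inner_sq_stdGaussian, sq, mul_left_comm] at h
  rcases (Finset.sum_nonneg fun i _ => sq_nonneg (t i)).eq_or_lt with h0 | h0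
  · exact h0 ▸ mul_nonneg C.coe_nonneg (variance_nonneg _ _)
  · exact le_of_mul_le_mul_left h h0

lemma sum_sq_variance_inner_sub_one_le (hν : ν ≤ C • stdGaussian E)
    (b : OrthonormalBasis ι ℝ E) :
    ∑ i, (Var[fun x => ⟪b i, x⟫; ν] - 1) ^ 2 ≤
      2 * (C * Var[fun x => x ^ 2; gaussianReal 0 1]) + 2 * C ^ 2 := by
  set m := ∫ x, x ∂ν
  have hmem : ∀ u : E, MemLp (fun x => ⟪u, x⟫) 2 ν := fun u =>
    memLp_of_le_smul hν (memLp_inner_stdGaussian u)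
  have hint : Integrable (fun x => x) ν :=
    (memLp_of_le_smul hν IsGaussian.memLp_two_id).integrable one_le_two
  have hvar : ∀ u : E, Var[fun x => ⟪u, x⟫; ν] = ∫ x, ⟪u, x⟫ ^ 2 ∂ν - ⟪u, m⟫ ^ 2 := fun u => by
    rw [variance_eq_sub (hmem u), integral_inner hint]
    rfl
  have hmean : ∑ i, (⟪b i, m⟫ ^ 2) ^ 2 ≤ (C : ℝ) ^ 2 := by
    calc ∑ i, (⟪b i, m⟫ ^ 2) ^ 2 ≤ (∑ i, ⟪b i, m⟫ ^ 2) ^ 2 :=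
          Finset.sum_sq_le_sq_sum_of_nonneg fun i _ => sq_nonneg _
      _ ≤ (C : ℝ) ^ 2 := by
          rw [b.sum_sq_inner_right]
          exact pow_le_pow_left₀ (sq_nonneg _) (norm_integral_id_sq_le hν) 2
  calc ∑ i, (Var[fun x => ⟪b i, x⟫; ν] - 1) ^ 2
      ≤ ∑ i, (2 * (∫ x, ⟪b i, x⟫ ^ 2 ∂ν - 1) ^ 2 + 2 * (⟪b i, m⟫ ^ 2) ^ 2) := by
        refine Finset.sum_le_sum fun i _ => ?_
        rw [hvar, sub_right_comm, sub_eq_add_neg, ← neg_sq (⟪b i, m⟫ ^ 2), ← mul_add]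
        exact add_sq_le
    _ ≤ _ := by
        rw [Finset.sum_add_distrib, ← Finset.mul_sum, ← Finset.mul_sum]
        gcongr
        exact sum_sq_integral_inner_sq_sub_one_le hν b

end SecondMoments

section CovMatrix

variable {ι : Type*} {ν : Measure (EuclideanSpace ℝ ι)} {C : NNReal}

/-- The covariance matrix of a law on `ℝ^ι`. -/
noncomputable def covMatrix (ν : Measure (EuclideanSpace ℝ ι)) : Matrix ι ι ℝ :=
  Matrix.of fun i j => cov[fun x => x i, fun x => x j; ν]

lemma isHermitian_covMatrix (ν : Measure (EuclideanSpace ℝ ι)) : (covMatrix ν).IsHermitian :=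
  Matrix.IsHermitian.ext fun _ _ => covariance_comm _ _

variable [Fintype ι]

lemma dotProduct_covMatrix_mulVec [IsFiniteMeasure ν] (hν : MemLp id 2 ν)
    (u : EuclideanSpace ℝ ι) :
    u.ofLp ⬝ᵥ covMatrix ν *ᵥ u.ofLp = Var[fun x => ⟪u, x⟫; ν] := by
  have hmem : ∀ i, MemLp (fun x : EuclideanSpace ℝ ι => u i * x i) 2 ν := fun i =>
    ((EuclideanSpace.proj (𝕜 := ℝ) i).comp_memLp' hν).const_mul (u i)
  have hinner : ∀ x : EuclideanSpace ℝ ι, ⟪u, x⟫ = ∑ i, u i * x i := fun x => by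
    simp [PiLp.inner_apply, mul_comm]
  simp_rw [hinner]
  rw [variance_fun_sum hmem]
  simp_rw [covariance_const_mul_left, covariance_const_mul_right, dotProduct, Matrix.mulVec,
    dotProduct, Finset.mul_sum, covMatrix, Matrix.of_apply, mul_comm (u _) (cov[_, _; ν])]

variable [DecidableEq ι]

lemma trace_sub_one_mul_self {S : Matrix ι ι ℝ} (hS : S.IsHermitian) :
    ((S - 1) * (S - 1)).trace = ∑ i, (hS.eigenvalues i - 1) ^ 2 := by
  set φ := Unitary.conjStarAlgAut ℝ _ hS.eigenvectorUnitary with hφ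
  have htrace : ∀ M, (φ M).trace = M.trace := fun M => by
    rw [hφ, Unitary.conjStarAlgAut_apply, Matrix.trace_mul_comm, ← mul_assoc,
      Unitary.coe_star_mul_self, one_mul]
  have hdiag : S - 1 = φ (Matrix.diagonal fun i => hS.eigenvalues i - 1) := by
    have h : S = φ (Matrix.diagonal hS.eigenvalues) := hS.spectral_theorem
    rw [← Matrix.diagonal_sub, Matrix.diagonal_one, map_sub, map_one, ← h]
  rw [hdiag, ← map_mul, htrace, Matrix.diagonal_mul_diagonal, Matrix.trace_diagonal]
  simp_rw [sq]

variable [IsProbabilityMeasure ν]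

lemma smul_one_le_covMatrix (hν : ν ≤ C • stdGaussian (EuclideanSpace ℝ ι)) :
    (Real.pi / (16 * C ^ 2)) • 1 ≤ covMatrix ν := by
  have hherm := (isHermitian_covMatrix ν).sub
    (Matrix.isHermitian_one.smul (IsSelfAdjoint.all (Real.pi / (16 * C ^ 2 : ℝ))))
  refine Matrix.le_iff.2 (.of_dotProduct_mulVec_nonneg hherm fun x => ?_)
  have h := le_variance_inner hν (WithLp.toLp 2 x)
  rw [← dotProduct_covMatrix_mulVec (memLp_of_le_smul hν IsGaussian.memLp_two_id),
    EuclideanSpace.real_norm_sq_eq] at h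
  rw [star_trivial, Matrix.sub_mulVec, Matrix.smul_mulVec, Matrix.one_mulVec, dotProduct_sub,
    dotProduct_smul, smul_eq_mul, sub_nonneg]
  simpa only [dotProduct, sq] using h

lemma trace_covMatrix_sub_one_mul_self_le (hν : ν ≤ C • stdGaussian (EuclideanSpace ℝ ι)) :
    ((covMatrix ν - 1) * (covMatrix ν - 1)).trace ≤
      2 * (C * Var[fun x => x ^ 2; gaussianReal 0 1]) + 2 * C ^ 2 := by
  have hherm := isHermitian_covMatrix ν
  have heig : ∀ i, hherm.eigenvalues i = Var[fun x => ⟪hherm.eigenvectorBasis i, x⟫; ν] := by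
    intro i
    rw [← dotProduct_covMatrix_mulVec (memLp_of_le_smul hν IsGaussian.memLp_two_id),
      hherm.eigenvalues_eq]
    rfl
  rw [trace_sub_one_mul_self hherm]
  simp_rw [heig]
  exact sum_sq_variance_inner_sub_one_le hν _

end CovMatrix

section Conditioning

variable {d : ℕ} {A : Set (EuclideanSpace ℝ (Fin d))}

lemma isProbabilityMeasure_condLaw (hA : f d A ≠ 0) : IsProbabilityMeasure (condLaw A) :=
  cond_isProbabilityMeasure hA

lemma condLaw_le {p : NNReal} (hp : 0 < p) (hpA : p ≤ f d A) : condLaw A ≤ p⁻¹ • f d := by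
  calc condLaw A = (f d A)⁻¹ • (f d).restrict A := rfl
    _ ≤ (p : ℝ≥0∞)⁻¹ • f d := by
        gcongr
        exact Measure.restrict_le_self
    _ = p⁻¹ • f d := by
        rw [← ENNReal.coe_inv hp.ne']
        rfl

lemma exists_condLaw_le {A : ∀ d : ℕ, Set (EuclideanSpace ℝ (Fin d))}
    (hpos : 0 < ⨅ (d : ℕ) (_ : 1 ≤ d), f d (A d)) :
    ∃ C : NNReal, (∀ d, 1 ≤ d → f d (A d) ≠ 0) ∧ ∀ d, 1 ≤ d → condLaw (A d) ≤ C • f d := by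
  obtain ⟨p, hp, hpA⟩ := ENNReal.lt_iff_exists_nnreal_btwn.1 hpos
  have hle : ∀ d, 1 ≤ d → p ≤ f d (A d) := fun d hd => hpA.le.trans (iInf₂_le d hd)
  exact ⟨p⁻¹, fun d hd => (hp.trans_le (hle d hd)).ne', fun d hd =>
    condLaw_le (by exact_mod_cast hp) (hle d hd)⟩

lemma covA_eq_covMatrix {C : NNReal} (hA : f d A ≠ 0) (hC : condLaw A ≤ C • f d) :
    covA A = covMatrix (condLaw A) := by
  have := isProbabilityMeasure_condLaw hA
  have hmem : MemLp id 2 (condLaw A) := memLp_of_le_smul hC IsGaussian.memLp_two_id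
  have hcoord : ∀ i, MemLp (fun x : EuclideanSpace ℝ (Fin d) => x i) 2 (condLaw A) := fun i =>
    (EuclideanSpace.proj (𝕜 := ℝ) i).comp_memLp' hmem
  have hmean : ∀ i, ∫ x, x i ∂(condLaw A) = meanA A i := fun i =>
    (EuclideanSpace.proj (𝕜 := ℝ) i).integral_comp_comm (hmem.integrable one_le_two)
  ext i j
  rw [covMatrix, Matrix.of_apply, covariance_eq_sub (hcoord i) (hcoord j), hmean, hmean]
  rfl

end Conditioning

section Asymptotics

lemma error_le_of_six_mul_sq_le {x y a b : ℝ} (ha : 0 ≤ a) (hb : 0 ≤ b) (hx : 1 ≤ x)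
    (hxy : 6 * x ^ 2 ≤ y) : ((x + 2) * (x * a) + y * b + x) / (y - x - 2) ≤ a + 2 * b + 1 := by
  have hgap : x * (x + 2) ≤ y - x - 2 := by nlinarith
  have hcoeff : y ≤ 2 * (y - x - 2) := by nlinarith
  rw [div_le_iff₀ (by nlinarith)]
  have ha' := mul_le_mul_of_nonneg_right hgap ha
  have hb' := mul_le_mul_of_nonneg_right hcoeff hb
  nlinarith

lemma sq_div_le_of_mul_le {x y K : ℝ} (hx : 1 ≤ x) (hK : 24 * K ≤ x) (hxy : x + 2 < y) :
    x ^ 2 / y / 16 ≤ (x ^ 2 / 4 - K * (x + 2)) / (y - x - 2) / 2 := by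
  have hnum : x ^ 2 / 8 ≤ x ^ 2 / 4 - K * (x + 2) := by nlinarith
  calc x ^ 2 / y / 16 = x ^ 2 / 8 / y / 2 := by ring
    _ ≤ (x ^ 2 / 4 - K * (x + 2)) / (y - x - 2) / 2 := by
        have hgap : 0 < y - x - 2 := by linarith
        have hpos : 0 ≤ x ^ 2 / 4 - K * (x + 2) := le_trans (by positivity) hnum
        gcongr
        linarith

variable {n : ℕ → ℕ} {Ω : ℕ → Type*} [∀ d, MeasurableSpace (Ω d)] {P : ∀ d, Measure (Ω d)}
  {Y : ∀ d, Fin (n d) → Ω d → EuclideanSpace ℝ (Fin d)} {v : ∀ d, EuclideanSpace ℝ (Fin d)}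
  {S : ∀ d, Matrix (Fin d) (Fin d) ℝ} {c K M : ℝ}

lemma iSup_expectedKL_lt_top (hc : 0 < c) (hS : ∀ d, 1 ≤ d → c • 1 ≤ S d)
    (hK : ∀ d, 1 ≤ d → ((S d - 1) * (S d - 1)).trace ≤ K) (hM : ∀ d, 1 ≤ d → ‖v d‖ ^ 2 ≤ M)
    (hlaw : ∀ d, 1 ≤ d → ∀ k, HasLaw (Y d k) (multivariateGaussian (v d) (S d)) (P d))
    (hindep : ∀ d, 1 ≤ d → iIndepFun (Y d) (P d))
    (hn : MuchLarger (fun d => n d) (fun d => (d : ℝ) ^ 2)) :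
    (⨆ (d : ℕ) (_ : 1 ≤ d) (_ : d + 3 ≤ n d), expectedKL (P d) (Y d)) < ∞ := by
  set error : ℕ → ℝ := fun d => ((d + 2) * (d / c) + n d * (M / c) + d) / (n d - d - 2)
  have hM0 : 0 ≤ M := (sq_nonneg _).trans (hM 1 le_rfl)
  have hbdd : IsBoundedUnder (· ≤ ·) atTop error := by
    refine isBoundedUnder_of_eventually_le (a := c⁻¹ + 2 * (M / c) + 1) ?_
    filter_upwards [hn.eventually_ge_atTop 6, eventually_ge_atTop 1] with d hd6 hd
    have hd' : (1 : ℝ) ≤ d := by exact_mod_cast hd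
    exact error_le_of_six_mul_sq_le (by positivity) (by positivity) hd'
      ((le_div_iff₀ (by positivity)).1 hd6)
  obtain ⟨R, hR⟩ := hbdd.bddAbove_range
  refine lt_of_le_of_lt (iSup_le fun d => iSup_le fun hd => iSup_le fun hdn => ?_)
    (ENNReal.ofReal_lt_top (r := (K / c + R) / 2))
  refine (expectedKL_le hc (hS d hd) (hK d hd) (hM d hd) hdn (hlaw d hd) (hindep d hd)).trans ?_
  have herror : error d ≤ R := hR ⟨d, rfl⟩
  gcongr

lemma tendsto_expectedKL_nhds_top (hS : ∀ d, 1 ≤ d → (S d).PosDef)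
    (hK : ∀ d, 1 ≤ d → ((S d - 1) * (S d - 1)).trace ≤ K)
    (hlaw : ∀ d, 1 ≤ d → ∀ k, HasLaw (Y d k) (multivariateGaussian (v d) (S d)) (P d))
    (hindep : ∀ d, 1 ≤ d → iIndepFun (Y d) (P d)) (hn : ∀ᶠ d in atTop, d + 3 ≤ n d)
    (hn2 : MuchLarger (fun d => (d : ℝ) ^ 2) (fun d => n d)) :
    Tendsto (fun d => expectedKL (P d) (Y d)) atTop (𝓝 ∞) := by
  refine tendsto_nhds_top_mono
    (ENNReal.tendsto_ofReal_nhds_top.2 (hn2.atTop_div_const (by norm_num : (0 : ℝ) < 16))) ?_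
  filter_upwards [hn, eventually_ge_atTop 1,
    tendsto_natCast_atTop_atTop.eventually_ge_atTop (24 * K)] with d hdn hd hdK
  have hd' : (1 : ℝ) ≤ d := by exact_mod_cast hd
  have hdn' : (d + 3 : ℝ) ≤ n d := by exact_mod_cast hdn
  exact (ENNReal.ofReal_le_ofReal (sq_div_le_of_mul_le hd' hdK (by linarith))).trans
    (le_expectedKL (hS d hd) (hK d hd) hdn (hlaw d hd) (hindep d hd))

lemma MuchLarger.eventually_add_three_le
    (hn : MuchLarger (fun d => (n d : ℝ)) (fun d => (d : ℝ))) : ∀ᶠ d in atTop, d + 3 ≤ n d := by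
  filter_upwards [hn.eventually_ge_atTop 4, eventually_ge_atTop 1] with d hd4 hd
  have h4 : (4 * d : ℝ) ≤ n d := (le_div_iff₀ (by positivity)).1 hd4
  have h4' : 4 * d ≤ n d := by exact_mod_cast h4
  omega

end Asymptotics

end GaussianIS

theorem proposition1_general
    {ν : ∀ d : ℕ, Measure (EuclideanSpace ℝ (Fin d))} {C : NNReal}
    (hprob : ∀ d, 1 ≤ d → IsProbabilityMeasure (ν d))
    (hC : ∀ d, 1 ≤ d → ν d ≤ C • GaussianIS.f d)
    {n : ℕ → ℕ} {Ω : ℕ → Type*} [∀ d, MeasurableSpace (Ω d)] {P : ∀ d, Measure (Ω d)}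
    {Y : ∀ d, Fin (n d) → Ω d → EuclideanSpace ℝ (Fin d)}
    (hlaw : ∀ d, 1 ≤ d → ∀ k, HasLaw (Y d k)
      (multivariateGaussian (∫ x, x ∂(ν d)) (GaussianIS.covMatrix (ν d))) (P d))
    (hindep : ∀ d, 1 ≤ d → iIndepFun (Y d) (P d)) :
    (GaussianIS.MuchLarger (fun d => (n d : ℝ)) (fun d => (d : ℝ) ^ 2) →
      (⨆ (d : ℕ) (_ : 1 ≤ d) (_ : d + 3 ≤ n d), GaussianIS.expectedKL (P d) (Y d)) < ∞) ∧
    ((∀ᶠ d in atTop, d + 3 ≤ n d) →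
      GaussianIS.MuchLarger (fun d => (d : ℝ) ^ 2) (fun d => (n d : ℝ)) →
      Tendsto (fun d => GaussianIS.expectedKL (P d) (Y d)) atTop (𝓝 ∞)) := by
  have hc : 0 < Real.pi / (16 * C ^ 2) := by
    have := hprob 1 le_rfl
    have hC0 : 0 < C := one_pos.trans_le (GaussianIS.one_le_of_le_smul (hC 1 le_rfl))
    have := Real.pi_pos
    positivity
  have hS := fun d hd => have := hprob d hd; GaussianIS.smul_one_le_covMatrix (hC d hd)
  have hK := fun d hd =>
    have := hprob d hd; GaussianIS.trace_covMatrix_sub_one_mul_self_le (hC d hd)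
  have hM := fun d hd => have := hprob d hd; GaussianIS.norm_integral_id_sq_le (hC d hd)
  exact ⟨GaussianIS.iSup_expectedKL_lt_top hc hS hK hM hlaw hindep,
    GaussianIS.tendsto_expectedKL_nhds_top
      (fun d hd => GaussianIS.posDef_of_smul_one_le hc (hS d hd)) hK hlaw hindep⟩

theorem proposition1
    (A : ∀ d : ℕ, Set (EuclideanSpace ℝ (Fin d)))
    (hA : ∀ d, 1 ≤ d → MeasurableSet (A d))
    (hpos : 0 < ⨅ (d : ℕ) (_ : 1 ≤ d), GaussianIS.f d (A d))
    (n : ℕ → ℕ)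
    {Ω : ℕ → Type*} [∀ d, MeasurableSpace (Ω d)]
    (P : ∀ d, Measure (Ω d)) [∀ d, IsProbabilityMeasure (P d)]
    (Y : ∀ d, Fin (n d) → Ω d → EuclideanSpace ℝ (Fin d))
    (hlaw : ∀ d, 1 ≤ d → ∀ k, HasLaw (Y d k)
      (multivariateGaussian (GaussianIS.meanA (A d)) (GaussianIS.covA (A d))) (P d))
    (hindep : ∀ d, 1 ≤ d → iIndepFun (Y d) (P d))
    (hn : GaussianIS.MuchLarger (fun d => (n d : ℝ)) (fun d => (d : ℝ))) :
    (GaussianIS.MuchLarger (fun d => (n d : ℝ)) (fun d => (d : ℝ) ^ 2) →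
      (⨆ (d : ℕ) (_ : 1 ≤ d) (_ : d + 3 ≤ n d), GaussianIS.expectedKL (P d) (Y d)) < ∞) ∧
    (GaussianIS.MuchLarger (fun d => (d : ℝ) ^ 2) (fun d => (n d : ℝ)) →
      Tendsto (fun d => GaussianIS.expectedKL (P d) (Y d)) atTop (𝓝 ∞)) := by
  obtain ⟨C, hA0, hC⟩ := GaussianIS.exists_condLaw_le hpos
  exact (proposition1_general (fun d hd => GaussianIS.isProbabilityMeasure_condLaw (hA0 d hd)) hC
    (fun d hd => GaussianIS.covA_eq_covMatrix (hA0 d hd) (hC d hd) ▸ hlaw d hd) hindep).imp_right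
      fun h => h hn.eventually_add_three_le
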